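/- For $c\in(1,2]$ and $s\in[\tfrac12,1]$ let $$h_c(s)=\int_0^{c}\frac{\log|1-\tau^2|}{\tau^{1+s}}\,d\tau+\int_c^{+\infty}\frac{\log(1+\tau)}{\tau^{1+s}}\,d\tau .$$ For $s\in(0,1)$, a normalizing constant $C_s>0$, $N\ge 1$, a unit vector $\xi\in\mathbb S^{N-1}\subset\mathbb R^N$ and a function $w$ on $\mathbb R^N$ let $$\mathcal I_\xi w(x)=C_s\int_0^{+\infty}\frac{w(x+\tau\xi)+w(x-\tau\xi)-2w(x)}{\tau^{1+2s}}\,d\tau,\qquad \mathcal I w(x)=\inf_{\xi\in\mathbb S^{N-1}}\mathcal I_\xi w(x)+\sup_{\xi\in\mathbb S^{N-1}}\mathcal I_\xi w(x).$$ A bounded function $u\in C(\mathbb R^N)$ is a viscosity solution of $\mathcal I u=0$ in $\mathbb R^N$ if for all $x_0\in\mathbb R^N$, $\rho>0$ and all $\varphi$ of class $C^2$ in a neighbourhood of $\overline{B_\rho(x_0)}$ with $\varphi(x_0)=u(x_0)$, the function $\psi$ equal to $\varphi$ on $\overline{B_\rho(x_0)}$ and to $u$ elsewhere satisfies $\mathcal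 I\psi(x_0)\ge 0$ if $u\le\varphi$ on $\overline{B_\rho(x_0)}$, and $\mathcal I\psi(x_0)\le 0$ if $u\ge\varphi$ on $\overline{B_\rho(x_0)}$. **Theorem.** Let $c\in(1,2]$. There is a (necessarily unique) number $s_0=s_0(c)\in(\tfrac12,1)$ such that $h_c>0$ on $[\tfrac12,s_0)$, $h_c(s_0)=0$ and $h_c<0$ on $(s_0,1]$; and for every $s\in(s_0,1)$, every $C_s>0$ and every $N\ge1$, every bounded viscosity solution $u\in C(\mathbb R^N)$ of $\mathcal I u=0$ in $\mathbb R^N$ is constant. -/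

import Mathlib

open Set MeasureTheory

noncomputable section

/-- Euclidean space `ℝᴺ` with its Euclidean norm. -/
abbrev RN (N : ℕ) : Type := EuclideanSpace ℝ (Fin N)

/-- The second difference `δ(u,x,y) = u(x+y) + u(x-y) - 2u(x)`. -/
def secondDiff {N : ℕ} (u : RN N → ℝ) (x y : RN N) : ℝ :=
  u (x + y) + u (x - y) - 2 * u x

/-- The one-dimensional fractional operator along `ξ`, with normalizing constant `C`:
`C ∫₀^∞ δ(u,x,τξ) τ^{-(1+2s)} dτ`. -/
def dirOp {N : ℕ} (C s : ℝ) (ξ : RN N) (u : RN N → ℝ) (x : RN N) : ℝ :=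
  C * ∫ τ in Ioi (0 : ℝ), secondDiff u x (τ • ξ) / τ ^ (1 + 2 * s)

/-- The Isaacs type operator: infimum plus supremum of `dirOp` over the unit sphere. -/
def isaacsOp {N : ℕ} (C s : ℝ) (u : RN N → ℝ) (x : RN N) : ℝ :=
  (⨅ ξ : Metric.sphere (0 : RN N) 1, dirOp C s (ξ : RN N) u x) +
    ⨆ ξ : Metric.sphere (0 : RN N) 1, dirOp C s (ξ : RN N) u x

open scoped Classical in
/-- The function equal to `φ` on the closed ball of radius `ρ` about `x₀` and to `u` elsewhere. -/
def glue {N : ℕ} (φ u : RN N → ℝ) (x₀ : RN N) (ρ : ℝ) : RN N → ℝ :=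
  fun x => if x ∈ Metric.closedBall x₀ ρ then φ x else u x

/-- `u` is a viscosity subsolution of `I u = f` in `Ω`: whenever `φ` is `C²` in a neighbourhood of
a closed ball about a point `x₀ ∈ Ω`, contained in `Ω`, and touches `u` from above at `x₀` on that
ball, then replacing `u` by `φ` on the ball gives a function `ψ` with `I ψ(x₀) ≥ f(x₀)`.
(`u` itself is taken bounded and continuous where this notion is used.) -/
def IsViscositySubsolution {N : ℕ} (C s : ℝ) (Ω : Set (RN N)) (f u : RN N → ℝ) : Prop :=
  ∀ (x₀ : RN N) (ρ : ℝ) (φ : RN N → ℝ), x₀ ∈ Ω → 0 < ρ → Metric.closedBall x₀ ρ ⊆ Ω →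
    (∀ x ∈ Metric.closedBall x₀ ρ, ContDiffAt ℝ 2 φ x) →
    u x₀ = φ x₀ → (∀ x ∈ Metric.closedBall x₀ ρ, u x ≤ φ x) →
    f x₀ ≤ isaacsOp C s (glue φ u x₀ ρ) x₀

/-- `u` is a viscosity supersolution of `I u = f` in `Ω`: the same with test functions touching
from below and the reverse inequality. -/
def IsViscositySupersolution {N : ℕ} (C s : ℝ) (Ω : Set (RN N)) (f u : RN N → ℝ) : Prop :=
  ∀ (x₀ : RN N) (ρ : ℝ) (φ : RN N → ℝ), x₀ ∈ Ω → 0 < ρ → Metric.closedBall x₀ ρ ⊆ Ω →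
    (∀ x ∈ Metric.closedBall x₀ ρ, ContDiffAt ℝ 2 φ x) →
    u x₀ = φ x₀ → (∀ x ∈ Metric.closedBall x₀ ρ, φ x ≤ u x) →
    isaacsOp C s (glue φ u x₀ ρ) x₀ ≤ f x₀

/-- A viscosity solution is both a subsolution and a supersolution. -/
def IsViscositySolution {N : ℕ} (C s : ℝ) (Ω : Set (RN N)) (f u : RN N → ℝ) : Prop :=
  IsViscositySubsolution C s Ω f u ∧ IsViscositySupersolution C s Ω f u

/-- `h_c(s) = ∫₀^c log|1-τ²| τ^{-(1+s)} dτ + ∫_c^∞ log(1+τ) τ^{-(1+s)} dτ`. -/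
def hFun (c s : ℝ) : ℝ :=
  (∫ τ in Ioo (0 : ℝ) c, Real.log |1 - τ ^ 2| / τ ^ (1 + s)) +
    ∫ τ in Ioi c, Real.log (1 + τ) / τ ^ (1 + s)

/-- `s₀ ∈ (1/2, 1)` is the point where `h_c` changes sign on `[1/2, 1]`: positive to the left of
`s₀`, zero at `s₀`, negative to the right. There is at most one such number for a given `c`. -/
def IsThreshold (c s₀ : ℝ) : Prop :=
  s₀ ∈ Ioo (1 / 2 : ℝ) 1 ∧ (∀ s ∈ Ico (1 / 2 : ℝ) s₀, 0 < hFun c s) ∧ hFun c s₀ = 0 ∧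
    ∀ s ∈ Ioc s₀ 1, hFun c s < 0

end

/-!
The threshold. Let `F_c` be the integrand of `h_c` without its power, `log|1 - τ²|` below `c` and
`log(1 + τ)` above. It changes sign once, from negative to positive, at `κ = min c √2`. Hence
`κ^s h_c(s) = ∫ F_c(τ) (κ/τ)^s dτ/τ` is strictly decreasing in `s` (`rpow_mul_hFun_strictAnti`).
Explicit antiderivatives give `h_c(1) = (1 - 1/c) log(c - 1) - log c < 0` and a closed form showing
`h_c(1/2) > 0`, and the intermediate value theorem yields `s₀` (`exists_isThreshold`).

The Liouville property. Suppose `h_c(s) < 0`. One doubles variables with a small power of the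
distance and shows `u(a) - u(b) ≤ ε |a - b|^α` for every `ε > 0` (`sub_le_mul_norm_rpow`). If this
fails, the function `u(p) - u(q) - ε |p - q|^α - β √(1 + |p|²)` has a maximum `(x, y)` with `x ≠ y`.
There, second differences of `u` at `x` and at `y` are compared by pairing `x ± tξ` with `y ± tη`.

* For arbitrary unit vectors `ξ` and `η`, the increment of `x - y` has length at most `2t`, and the
  gain is at most that of an increment of length `2t` orthogonal to `x - y`
  (`IsDoublingMax.secondDiff_sub_le`).
* For `ξ = η` parallel to `x - y` the pairing may be chosen for each `t` separately: `x ± te` with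
  `y ∓ te`, which profits from the concavity of the power, or `x ± te` with `y ± te`, which gives
  zero. One uses the first while `4t² < c |x - y|²`
  (`IsDoublingMax.secondDiff_radial_sub_le`).

As the operator is an infimum plus a supremum, subtracting the two viscosity inequalities gives one
term of each kind (`nonneg_of_inf_add_sup`). After rescaling, their sum is a positive multiple,
bounded below independently of `β`, of the integral of `orthGain α + radialGain c α`. Divided by
`α`, this integral tends to `h_c(s) / 2` as `α → 0`, so it is negative for some small `α`
(`exists_integral_gain_neg`). The penalization contributes `O(β)`, and `β → 0` is a contradiction.
-/

open Filter Topology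

/-! ### Integrability of the logarithmic kernels -/

theorem abs_log_one_sub_sq_le {x : ℝ} (h0 : 0 ≤ x) (h1 : x ≤ 1 / 2) :
    |Real.log (1 - x ^ 2)| ≤ 2 * x ^ 2 := by
  have hx : x ^ 2 ≤ 1 / 4 := by nlinarith
  have hpos : (0 : ℝ) < 1 - x ^ 2 := by linarith
  have h2 := Real.one_sub_inv_le_log_of_pos hpos
  have h3 : Real.log (1 - x ^ 2) ≤ 0 := Real.log_nonpos hpos.le (by nlinarith [sq_nonneg x])
  have h4 : (1 - x ^ 2)⁻¹ ≤ 1 + 2 * x ^ 2 := by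
    rw [inv_le_iff_one_le_mul₀ hpos]
    nlinarith [sq_nonneg x]
  rw [abs_of_nonpos h3]
  linarith

theorem measurable_log_abs_one_sub_sq_div_rpow (p : ℝ) :
    Measurable fun x : ℝ => Real.log |1 - x ^ 2| / x ^ p := by
  fun_prop

theorem integrableOn_log_abs_one_sub_sq_div_rpow {p b : ℝ} (hp : p < 3) :
    IntegrableOn (fun x : ℝ => Real.log |1 - x ^ 2| / x ^ p) (Ioo 0 b) := by
  have hnear : IntegrableOn (fun x : ℝ => Real.log |1 - x ^ 2| / x ^ p) (Ioc 0 (1 / 2)) := by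
    have hi : IntegrableOn (fun x : ℝ => 2 * x ^ (2 - p)) (Ioc 0 (1 / 2)) := by
      have := (intervalIntegral.intervalIntegrable_rpow' (a := 0) (b := 1 / 2) (r := 2 - p)
        (by linarith)).const_mul 2
      rwa [intervalIntegrable_iff_integrableOn_Ioc_of_le (by norm_num)] at this
    refine hi.mono' (measurable_log_abs_one_sub_sq_div_rpow p).aestronglyMeasurable ?_
    refine (ae_restrict_iff' measurableSet_Ioc).2 (ae_of_all _ fun x hx => ?_)
    have hxp : 0 < x ^ p := Real.rpow_pos_of_pos hx.1 p
    rw [Real.log_abs, Real.norm_eq_abs, abs_div, abs_of_pos hxp, div_le_iff₀ hxp, mul_assoc,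
      ← Real.rpow_add hx.1]
    simpa using abs_log_one_sub_sq_le hx.1.le hx.2
  have hfar : IntegrableOn (fun x : ℝ => Real.log |1 - x ^ 2| / x ^ p) (Ioc (1 / 2) b) := by
    rcases le_total b (1 / 2) with hb | hb
    · rw [Ioc_eq_empty_of_le hb]
      exact integrableOn_empty
    have h1 : IntervalIntegrable (fun x : ℝ => Real.log (1 - x)) volume (1 / 2) b := by
      have := (intervalIntegral.intervalIntegrable_log' (a := 1 - 1 / 2)
        (b := 1 - b)).comp_sub_left 1
      simpa using this
    have hc1 : ContinuousOn (fun x : ℝ => Real.log (1 + x)) (uIcc (1 / 2) b) := by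
      rw [uIcc_of_le hb]
      refine ContinuousOn.log (by fun_prop) fun x hx => ?_
      have := hx.1
      linarith
    have hc2 : ContinuousOn (fun x : ℝ => (x ^ p)⁻¹) (uIcc (1 / 2) b) := by
      rw [uIcc_of_le hb]
      have hx0 : ∀ x ∈ Icc (1 / 2 : ℝ) b, 0 < x := fun x hx => by
        have := hx.1
        linarith
      refine ContinuousOn.inv₀ (ContinuousOn.rpow_const continuousOn_id
        fun x hx => Or.inl (hx0 x hx).ne') fun x hx => (Real.rpow_pos_of_pos (hx0 x hx) p).ne'
    have h2 := (h1.add hc1.intervalIntegrable).mul_continuousOn hc2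
    rw [intervalIntegrable_iff_integrableOn_Ioc_of_le hb] at h2
    refine h2.congr ?_
    have h1ae : ∀ᵐ x : ℝ, x ≠ 1 := by simp [ae_iff]
    refine (ae_restrict_iff' measurableSet_Ioc).2 (h1ae.mono fun x hx1 hx => ?_)
    have hx0 : 0 < x := by
      have := hx.1
      linarith
    have e : 1 - x ^ 2 = (1 - x) * (1 + x) := by ring
    beta_reduce
    rw [Real.log_abs, e, Real.log_mul (sub_ne_zero.2 hx1.symm) (by linarith), div_eq_mul_inv]
  refine (hnear.union hfar).mono_set fun x hx => ?_
  rcases le_total x (1 / 2) with h | h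
  · exact Or.inl ⟨hx.1, h⟩
  · rcases h.eq_or_lt with h' | h'
    · exact Or.inl ⟨hx.1, h'.symm.le⟩
    · exact Or.inr ⟨h', hx.2.le⟩

theorem integrableOn_log_one_add_div_rpow {p b : ℝ} (hp : 1 < p) (hb : 0 < b) :
    IntegrableOn (fun x : ℝ => Real.log (1 + x) / x ^ p) (Ioi b) := by
  set q : ℝ := (p - 1) / 2 with hq
  have hq0 : 0 < q := by rw [hq]; linarith
  have hi : IntegrableOn (fun x : ℝ => ((1 + b⁻¹) ^ q / q) * x ^ (q - p)) (Ioi b) :=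
    (integrableOn_Ioi_rpow_of_lt (by rw [hq]; linarith) hb).const_mul _
  refine hi.mono' (by fun_prop : Measurable _).aestronglyMeasurable ?_
  refine (ae_restrict_iff' measurableSet_Ioi).2 (ae_of_all _ fun x (hx : b < x) => ?_)
  have hx0 : 0 < x := hb.trans hx
  have hxp : 0 < x ^ p := Real.rpow_pos_of_pos hx0 p
  have hlog : 0 ≤ Real.log (1 + x) := Real.log_nonneg (by linarith)
  rw [Real.norm_eq_abs, abs_of_nonneg (div_nonneg hlog hxp.le), div_le_iff₀ hxp, mul_assoc,
    ← Real.rpow_add hx0, sub_add_cancel]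
  refine (Real.log_le_rpow_div (by linarith) hq0).trans ?_
  rw [div_mul_eq_mul_div, ← Real.mul_rpow (by positivity) hx0.le]
  have : 1 ≤ b⁻¹ * x := by
    rw [inv_mul_eq_div, one_le_div hb]
    exact hx.le
  gcongr
  linarith

/-- The two integrands in `h_c` joined into one function on the half-line. -/
noncomputable def logKernel (c τ : ℝ) : ℝ :=
  if τ < c then Real.log |1 - τ ^ 2| else Real.log (1 + τ)

theorem measurable_logKernel (c : ℝ) : Measurable (logKernel c) := by
  unfold logKernel
  exact Measurable.ite measurableSet_Iio (by fun_prop) (by fun_prop)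

theorem integrableOn_logKernel_div_rpow {c p : ℝ} (hc : 0 < c) (h1 : 1 < p) (h3 : p < 3) :
    IntegrableOn (fun τ : ℝ => logKernel c τ / τ ^ p) (Ioi 0) := by
  rw [← Ioo_union_Ici_eq_Ioi hc]
  refine IntegrableOn.union ?_ ?_
  · refine (integrableOn_log_abs_one_sub_sq_div_rpow h3).congr_fun (fun τ hτ => ?_)
      measurableSet_Ioo
    simp [logKernel, hτ.2]
  · rw [integrableOn_Ici_iff_integrableOn_Ioi]
    refine (integrableOn_log_one_add_div_rpow h1 hc).congr_fun (fun τ hτ => ?_) measurableSet_Ioi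
    simp [logKernel, not_lt.2 (le_of_lt (show c < τ from hτ))]

theorem hFun_eq_integral_logKernel {c s : ℝ} (hc : 0 < c) (h0 : 0 < s) (h2 : s < 2) :
    hFun c s = ∫ τ in Ioi (0 : ℝ), logKernel c τ / τ ^ (1 + s) := by
  have hi := integrableOn_logKernel_div_rpow hc (p := 1 + s) (by linarith) (by linarith)
  have hd : Disjoint (Ioo 0 c) (Ici c) := by
    rw [Set.disjoint_left]
    intro x hx hx'
    exact absurd hx.2 (not_lt.2 hx')
  rw [← Ioo_union_Ici_eq_Ioi hc] at hi ⊢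
  rw [setIntegral_union hd measurableSet_Ici hi.left_of_union hi.right_of_union,
    integral_Ici_eq_integral_Ioi, hFun]
  congr 1
  · refine setIntegral_congr_fun measurableSet_Ioo fun τ hτ => ?_
    simp [logKernel, hτ.2]
  · refine setIntegral_congr_fun measurableSet_Ioi fun τ hτ => ?_
    simp [logKernel, not_lt.2 (le_of_lt (show c < τ from hτ))]

/-! ### The threshold -/

/-- The continuous function `σ ↦ (1-σ) log|1-σ| + (1+σ) log(1+σ)` in terms of which the integrals
of `log|1-τ²|` against `τ⁻²` and `τ^(-3/2)` are expressed. -/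
noncomputable def entropySum (σ : ℝ) : ℝ :=
  (1 - σ) * Real.log (1 - σ) + (1 + σ) * Real.log (1 + σ)

theorem continuous_entropySum : Continuous entropySum := by
  have := Real.continuous_mul_log
  exact (this.comp (by fun_prop : Continuous fun σ : ℝ => 1 - σ)).add
    (this.comp (by fun_prop : Continuous fun σ : ℝ => 1 + σ))

theorem hasDerivAt_entropySum {σ : ℝ} (h1 : σ ≠ 1) (h2 : 1 + σ ≠ 0) :
    HasDerivAt entropySum (Real.log (1 + σ) - Real.log (1 - σ)) σ := by
  have a := (Real.hasDerivAt_mul_log (sub_ne_zero.2 h1.symm)).comp σ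
    ((hasDerivAt_id σ).const_sub 1)
  have b := (Real.hasDerivAt_mul_log h2).comp σ ((hasDerivAt_id σ).const_add 1)
  exact (a.add b).congr_deriv (by ring)

/-- The value `f 0 / 0 = 0` is the right one, so the quotient is continuous at `0` too. -/
theorem continuous_div_self_of_hasDerivAt_zero {f : ℝ → ℝ} (hf : Continuous f) (h0 : f 0 = 0)
    (hd : HasDerivAt f 0 0) : Continuous fun x => f x / x := by
  have e : (fun x => f x / x) = dslope f 0 := by
    funext x
    rcases eq_or_ne x 0 with rfl | hx
    · simp [hd.deriv]
    · rw [dslope_of_ne _ hx, slope_def_field, h0, sub_zero, sub_zero]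
  rw [e, continuous_iff_continuousAt]
  intro x
  rcases eq_or_ne x 0 with rfl | hx
  · exact continuousAt_dslope_same.2 hd.differentiableAt
  · exact (continuousAt_dslope_of_ne hx).2 hf.continuousAt

theorem integral_log_abs_one_sub_sq_div_sq {c : ℝ} (hc : 1 < c) :
    ∫ τ in Ioo (0 : ℝ) c, Real.log |1 - τ ^ 2| / τ ^ (1 + (1 : ℝ)) = -(entropySum c / c) := by
  rw [← integral_Ioc_eq_integral_Ioo, ← intervalIntegral.integral_of_le (by linarith)]
  have hcont : Continuous fun x : ℝ => -(entropySum x / x) :=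
    (continuous_div_self_of_hasDerivAt_zero continuous_entropySum (by simp [entropySum]) (by
      simpa using hasDerivAt_entropySum (σ := 0) (by norm_num) (by norm_num))).neg
  rw [integral_eq_of_hasDerivAt_off_countable_of_le (fun x : ℝ => -(entropySum x / x)) _
    (by linarith) (countable_singleton (1 : ℝ)) hcont.continuousOn]
  · simp
  · rintro x ⟨⟨hx0, -⟩, hx1⟩
    have hx1' : x ≠ 1 := hx1
    refine (((hasDerivAt_entropySum hx1' (by linarith)).div (hasDerivAt_id x)
      hx0.ne').neg).congr_deriv ?_
    have e : 1 - x ^ 2 = (1 - x) * (1 + x) := by ring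
    rw [Real.log_abs, e, Real.log_mul (sub_ne_zero.2 hx1'.symm) (by linarith),
      show (1 + 1 : ℝ) = (2 : ℕ) by norm_num, Real.rpow_natCast, entropySum]
    simp only [id]
    field_simp
    ring
  · rw [intervalIntegrable_iff_integrableOn_Ioo_of_le (by linarith)]
    exact integrableOn_log_abs_one_sub_sq_div_rpow (by norm_num)

theorem integral_log_one_add_div_sq {c : ℝ} (hc : 0 < c) :
    ∫ τ in Ioi c, Real.log (1 + τ) / τ ^ (1 + (1 : ℝ)) =
      Real.log (1 + c) / c + Real.log (1 + c) - Real.log c := by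
  have hd : ∀ x ∈ Ici c, HasDerivAt (fun x : ℝ => -(Real.log (1 + x) / x) +
      Real.log (x / (1 + x))) (Real.log (1 + x) / x ^ (1 + (1 : ℝ))) x := by
    intro x hx
    have hx0 : 0 < x := lt_of_lt_of_le hc hx
    have a := ((hasDerivAt_id x).const_add 1).log (by simp; linarith)
    have b := ((hasDerivAt_id x).div ((hasDerivAt_id x).const_add 1) (by simp; linarith)).log
      (by simp; constructor <;> linarith)
    refine ((a.div (hasDerivAt_id x) hx0.ne').neg.add b).congr_deriv ?_
    rw [show (1 + 1 : ℝ) = (2 : ℕ) by norm_num, Real.rpow_natCast]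
    simp only [id, Pi.div_apply]
    field_simp
    ring
  rw [integral_Ioi_of_hasDerivAt_of_tendsto (m := 0)
    (hd c self_mem_Ici).continuousAt.continuousWithinAt (fun x hx => hd x (Ioi_subset_Ici_self hx))
    (integrableOn_log_one_add_div_rpow (by norm_num) hc)]
  · rw [Real.log_div hc.ne' (by linarith)]
    ring
  · have t1 : Tendsto (fun x : ℝ => Real.log (1 + x) / x) atTop (𝓝 0) := by
      have h := (Real.isLittleO_log_id_atTop.tendsto_div_nhds_zero.comp
        (tendsto_atTop_add_const_left atTop (1 : ℝ) tendsto_id))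
      have h2 : Tendsto (fun x : ℝ => 1 / x + 1) atTop (𝓝 (0 + 1)) :=
        (tendsto_const_nhds.div_atTop tendsto_id).add_const 1
      have h3 := h.mul h2
      rw [zero_mul] at h3
      refine h3.congr' ?_
      filter_upwards [eventually_gt_atTop 0] with x hx
      simp only [Function.comp, id]
      field_simp
    have t2 : Tendsto (fun x : ℝ => Real.log (x / (1 + x))) atTop (𝓝 0) := by
      have h2 : Tendsto (fun x : ℝ => 1 / x + 1) atTop (𝓝 (0 + 1)) :=
        (tendsto_const_nhds.div_atTop tendsto_id).add_const 1
      have h3 := (h2.inv₀ (by norm_num)).log (by norm_num)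
      simp only [zero_add, inv_one, Real.log_one] at h3
      refine h3.congr' ?_
      filter_upwards [eventually_gt_atTop 0] with x hx
      congr 1
      field_simp
    simpa using t1.neg.add t2

theorem hFun_one {c : ℝ} (hc : 1 < c) :
    hFun c 1 = (1 - 1 / c) * Real.log (c - 1) - Real.log c := by
  have hlog : Real.log (1 - c) = Real.log (c - 1) := by
    rw [← Real.log_neg_eq_log, neg_sub]
  rw [hFun, integral_log_abs_one_sub_sq_div_sq hc, integral_log_one_add_div_sq (by linarith),
    entropySum, hlog]
  field_simp
  ring

theorem hFun_one_neg {c : ℝ} (hc : c ∈ Ioc (1 : ℝ) 2) : hFun c 1 < 0 := by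
  rw [hFun_one hc.1]
  have h1 : 0 < Real.log c := Real.log_pos hc.1
  have h2 : Real.log (c - 1) ≤ 0 :=
    Real.log_nonpos (by linarith [hc.1]) (by linarith [hc.2])
  have h3 : 0 ≤ 1 - 1 / c := by
    rw [sub_nonneg, div_le_one (by linarith [hc.1])]
    exact hc.1.le
  nlinarith [mul_nonneg h3 (neg_nonneg.2 h2)]

theorem rpow_three_halves {x : ℝ} (hx : 0 < x) : x ^ (1 + (1 / 2 : ℝ)) = √x ^ 3 := by
  rw [Real.rpow_add hx, Real.rpow_one, ← Real.sqrt_eq_rpow]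
  nth_rewrite 1 [← Real.sq_sqrt hx.le]
  ring

theorem integral_log_abs_one_sub_sq_div_three_halves {c : ℝ} (hc : 1 < c) :
    ∫ τ in Ioo (0 : ℝ) c, Real.log |1 - τ ^ 2| / τ ^ (1 + (1 / 2 : ℝ)) =
      -2 * ((entropySum √c + Real.log (1 + c)) / √c) + 4 * Real.arctan √c := by
  rw [← integral_Ioc_eq_integral_Ioo, ← intervalIntegral.integral_of_le (by linarith)]
  set E : ℝ → ℝ := fun σ => entropySum σ + Real.log (1 + σ ^ 2) with hE
  have hlog : ∀ σ : ℝ, HasDerivAt (fun σ : ℝ => Real.log (1 + σ ^ 2)) (2 * σ / (1 + σ ^ 2)) σ := by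
    intro σ
    have := ((hasDerivAt_pow 2 σ).const_add 1).log (by positivity)
    simpa using this
  have hEc : Continuous E :=
    continuous_entropySum.add (Continuous.log (by fun_prop) fun x => by positivity)
  have hE' : ∀ σ : ℝ, σ ≠ 1 → 1 + σ ≠ 0 →
      HasDerivAt E (Real.log (1 + σ) - Real.log (1 - σ) + 2 * σ / (1 + σ ^ 2)) σ :=
    fun σ h1 h2 => (hasDerivAt_entropySum h1 h2).add (hlog σ)
  set B : ℝ → ℝ := fun σ => -2 * (E σ / σ) + 4 * Real.arctan σ with hB
  have hBc : Continuous B :=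
    ((continuous_div_self_of_hasDerivAt_zero hEc (by simp [hE, entropySum]) (by
      simpa using hE' 0 (by norm_num) (by norm_num))).const_mul _).add (by fun_prop)
  rw [integral_eq_of_hasDerivAt_off_countable_of_le (fun x : ℝ => B √x) _
    (by linarith) (countable_singleton (1 : ℝ)) (hBc.comp Real.continuous_sqrt).continuousOn]
  · simp [hB, hE, Real.sq_sqrt (by linarith : 0 ≤ c)]
  · rintro x ⟨⟨hx0, -⟩, hx1⟩
    have hx1' : x ≠ 1 := hx1
    have hs0 : 0 < √x := Real.sqrt_pos.2 hx0
    have hs1 : √x ≠ 1 := by simpa using hx1'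
    have hBd : HasDerivAt B (2 * (Real.log (1 - √x) + Real.log (1 + √x) +
        Real.log (1 + √x ^ 2)) / √x ^ 2) √x := by
      refine ((((hE' √x hs1 (by linarith)).div (hasDerivAt_id √x) hs0.ne').const_mul (-2)).add
        ((Real.hasDerivAt_arctan √x).const_mul 4)).congr_deriv ?_
      simp only [id, hE, entropySum]
      have : (1 + √x ^ 2) ≠ 0 := by positivity
      field_simp
      ring
    refine (hBd.comp x (Real.hasDerivAt_sqrt hx0.ne')).congr_deriv ?_
    have e : 1 - x ^ 2 = (1 - √x) * (1 + √x) * (1 + √x ^ 2) := by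
      have := Real.sq_sqrt hx0.le
      rw [show (1 - √x) * (1 + √x) * (1 + √x ^ 2) = 1 - (√x ^ 2) ^ 2 by ring, this]
    have hne : 1 - √x ≠ 0 := sub_ne_zero.2 hs1.symm
    rw [Real.log_abs, e, Real.log_mul (mul_ne_zero hne (by positivity)) (by positivity),
      Real.log_mul hne (by positivity), rpow_three_halves hx0]
    field_simp
  · rw [intervalIntegrable_iff_integrableOn_Ioo_of_le (by linarith)]
    exact integrableOn_log_abs_one_sub_sq_div_rpow (by norm_num)

theorem integral_log_one_add_div_three_halves {c : ℝ} (hc : 0 < c) :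
    ∫ τ in Ioi c, Real.log (1 + τ) / τ ^ (1 + (1 / 2 : ℝ)) =
      2 * Real.pi + 2 * (Real.log (1 + c) / √c) - 4 * Real.arctan √c := by
  have hd : ∀ x ∈ Ici c, HasDerivAt (fun x : ℝ => -2 * (Real.log (1 + x) / √x) +
      4 * Real.arctan √x) (Real.log (1 + x) / x ^ (1 + (1 / 2 : ℝ))) x := by
    intro x hx
    have hx0 : 0 < x := lt_of_lt_of_le hc hx
    have hs0 : 0 < √x := Real.sqrt_pos.2 hx0
    have a := ((hasDerivAt_id x).const_add 1).log (by simp; linarith)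
    have hs := Real.hasDerivAt_sqrt hx0.ne'
    refine (((a.div hs hs0.ne').const_mul (-2)).add (hs.arctan.const_mul 4)).congr_deriv ?_
    rw [rpow_three_halves hx0]
    have hq := Real.sq_sqrt hx0.le
    simp only [id, hq]
    have h1 : 1 + x ≠ 0 := by positivity
    have hx3 : √x ^ 3 = x * √x := by rw [pow_succ, hq]
    rw [hx3]
    field_simp
    rw [hq]
    ring
  rw [integral_Ioi_of_hasDerivAt_of_tendsto (m := 2 * Real.pi)
    (hd c self_mem_Ici).continuousAt.continuousWithinAt (fun x hx => hd x (Ioi_subset_Ici_self hx))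
    (integrableOn_log_one_add_div_rpow (by norm_num) hc)]
  · ring
  · have t1 : Tendsto (fun x : ℝ => Real.log (1 + x) / √x) atTop (𝓝 0) := by
      have h := (isLittleO_log_rpow_atTop (r := 1 / 2)
        (by norm_num)).tendsto_div_nhds_zero.comp
        (tendsto_atTop_add_const_left atTop (1 : ℝ) tendsto_id)
      have h2 : Tendsto (fun x : ℝ => √(1 / x + 1)) atTop (𝓝 √(0 + 1)) :=
        ((tendsto_const_nhds.div_atTop tendsto_id).add_const 1).sqrt
      have h3 := h.mul h2
      rw [zero_mul] at h3
      refine h3.congr' ?_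
      filter_upwards [eventually_gt_atTop 0] with x hx
      simp only [Function.comp, id]
      rw [← Real.sqrt_eq_rpow, show 1 / x + 1 = (1 + x) / x by field_simp,
        Real.sqrt_div (by positivity)]
      have : √(1 + x) ≠ 0 := by positivity
      have : √x ≠ 0 := by positivity
      field_simp
    have t2 : Tendsto (fun x : ℝ => Real.arctan √x) atTop (𝓝 (Real.pi / 2)) :=
      (Real.tendsto_arctan_atTop.mono_right nhdsWithin_le_nhds).comp Real.tendsto_sqrt_atTop
    have := (t1.const_mul (-2)).add (t2.const_mul 4)
    convert this using 2
    ring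

theorem hFun_half {c : ℝ} (hc : 1 < c) :
    hFun c (1 / 2) = 2 * Real.pi - 2 * (entropySum √c / √c) := by
  rw [hFun, integral_log_abs_one_sub_sq_div_three_halves hc,
    integral_log_one_add_div_three_halves (by linarith)]
  ring

/-- Since `c ≤ 2`, the two entropy terms can be estimated by `log (1 + b) ≤ 1` and
`log y ≥ 1 - 1/y`, which leaves `h_c(1/2) > 2π - 6`. -/
theorem hFun_half_pos {c : ℝ} (hc : c ∈ Ioc (1 : ℝ) 2) : 0 < hFun c (1 / 2) := by
  rw [hFun_half hc.1]
  set b := √c with hb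
  have hb1 : 1 < b := by
    rw [hb, Real.lt_sqrt (by norm_num)]
    simpa using hc.1
  have hb2 : b ^ 2 = c := Real.sq_sqrt (by linarith [hc.1])
  have hb3 : b < 3 / 2 := by nlinarith [hc.2]
  have h1 : Real.log (1 + b) ≤ 1 := by
    rw [Real.log_le_iff_le_exp (by linarith)]
    linarith [Real.exp_one_gt_d9]
  have h2 : (1 - b) * Real.log (1 - b) ≤ 2 - b := by
    rw [← Real.log_neg_eq_log, neg_sub]
    have h := Real.one_sub_inv_le_log_of_pos (sub_pos.2 hb1)
    have h' : (b - 1) * (1 - (b - 1)⁻¹) ≤ (b - 1) * Real.log (b - 1) :=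
      mul_le_mul_of_nonneg_left h (by linarith)
    rw [mul_sub, mul_inv_cancel₀ (by linarith)] at h'
    linarith
  have h4 : entropySum b / b < 3 := by
    rw [div_lt_iff₀ (by linarith), entropySum]
    nlinarith
  linarith [Real.pi_gt_three]

theorem logKernel_nonpos {c τ : ℝ} (h0 : 0 < τ) (hτ : τ < min c √2) : logKernel c τ ≤ 0 := by
  have h2 : τ ^ 2 < 2 := by
    rw [← Real.lt_sqrt h0.le]
    exact hτ.trans_le (min_le_right _ _)
  rw [logKernel, if_pos (hτ.trans_le (min_le_left _ _))]
  refine Real.log_nonpos (abs_nonneg _) (abs_le.2 ⟨by linarith, by nlinarith⟩)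

theorem logKernel_nonneg {c τ : ℝ} (h0 : 0 < τ) (hτ : min c √2 ≤ τ) : 0 ≤ logKernel c τ := by
  rw [logKernel]
  split_ifs with h
  · have h1 : √2 ≤ τ := (min_le_iff.1 hτ).resolve_left (not_le.2 h)
    have h2 : 2 ≤ τ ^ 2 := (Real.sqrt_le_left h0.le).1 h1
    refine Real.log_nonneg ?_
    rw [abs_sub_comm]
    exact le_trans (by linarith) (le_abs_self _)
  · exact Real.log_nonneg (by linarith)

theorem logKernel_neg {c τ : ℝ} (hc : 1 < c) (h0 : 0 < τ) (hτ : τ < 1) : logKernel c τ < 0 := by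
  have h2 : τ ^ 2 < 1 := by nlinarith
  rw [logKernel, if_pos (hτ.trans hc)]
  refine Real.log_neg (abs_pos.2 (by linarith)) ?_
  rw [abs_of_pos (by linarith)]
  nlinarith [pow_pos h0 2]

/-- The kernel changes sign once, at `κ = min c √2`, so that multiplying by `κ ^ s` makes the
integrand `F(τ) (κ/τ)^s / τ` decreasing in `s` for every `τ`. -/
theorem rpow_mul_hFun_strictAnti {c s t : ℝ} (hc : 1 < c) (h0 : 0 < s) (hst : s < t) (ht : t < 2) :
    min c √2 ^ t * hFun c t < min c √2 ^ s * hFun c s := by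
  set κ := min c √2 with hκ
  have hκ1 : 1 < κ := lt_min hc (by rw [Real.lt_sqrt (by norm_num)]; norm_num)
  have hκ0 : 0 < κ := by linarith
  have hi : ∀ r : ℝ, 0 < r → r < 2 →
      IntegrableOn (fun τ : ℝ => κ ^ r * (logKernel c τ / τ ^ (1 + r))) (Ioi 0) := fun r h h' =>
    (integrableOn_logKernel_div_rpow (by linarith) (by linarith) (by linarith)).const_mul _
  rw [hFun_eq_integral_logKernel (by linarith) h0 (by linarith),
    hFun_eq_integral_logKernel (by linarith) (h0.trans hst) ht,
    ← integral_const_mul, ← integral_const_mul, ← sub_pos,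
    ← integral_sub (hi s h0 (by linarith)) (hi t (by linarith) ht)]
  have key : ∀ r τ : ℝ, 0 < τ → κ ^ r * (logKernel c τ / τ ^ (1 + r)) =
      logKernel c τ / τ * (κ / τ) ^ r := by
    intro r τ hτ
    rw [Real.rpow_add hτ, Real.rpow_one, Real.div_rpow hκ0.le hτ.le]
    ring
  rw [setIntegral_pos_iff_support_of_nonneg_ae]
  · refine lt_of_lt_of_le (?_ : 0 < volume (Ioo (0 : ℝ) 1)) (measure_mono fun τ hτ => ?_)
    · simp
    · refine ⟨?_, hτ.1⟩
      rw [Function.mem_support, key _ _ hτ.1, key _ _ hτ.1, ← mul_sub]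
      refine mul_ne_zero (div_ne_zero (logKernel_neg hc hτ.1 hτ.2).ne hτ.1.ne') (sub_ne_zero.2 ?_)
      refine (Real.rpow_lt_rpow_of_exponent_lt ?_ hst).ne
      rw [one_lt_div hτ.1]
      exact hτ.2.trans hκ1
  · refine (ae_restrict_iff' measurableSet_Ioi).2 (ae_of_all _ fun τ (hτ : 0 < τ) => ?_)
    simp only [Pi.zero_apply]
    rw [key _ _ hτ, key _ _ hτ, ← mul_sub]
    rcases lt_or_ge τ κ with h | h
    · refine mul_nonneg_of_nonpos_of_nonpos
        (div_nonpos_of_nonpos_of_nonneg (logKernel_nonpos hτ h) hτ.le) (sub_nonpos.2 ?_)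
      refine Real.rpow_le_rpow_of_exponent_le ?_ hst.le
      rw [one_le_div hτ]
      exact h.le
    · refine mul_nonneg (div_nonneg (logKernel_nonneg hτ h) hτ.le) (sub_nonneg.2 ?_)
      exact Real.rpow_le_rpow_of_exponent_ge (by positivity) ((div_le_one hτ).2 h) hst.le
  · exact (hi s h0 (by linarith)).sub (hi t (by linarith) ht)

theorem continuousOn_hFun {c : ℝ} (hc : 0 < c) : ContinuousOn (hFun c) (Icc (1 / 2) 1) := by
  have h : ContinuousOn (fun s : ℝ => ∫ τ in Ioi (0 : ℝ), logKernel c τ / τ ^ (1 + s))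
      (Icc (1 / 2) 1) := by
    refine continuousOn_of_dominated (bound := fun τ =>
      ‖logKernel c τ / τ ^ (1 + (1 / 2 : ℝ))‖ + ‖logKernel c τ / τ ^ (1 + (1 : ℝ))‖) ?_ ?_ ?_ ?_
    · intro s hs
      exact ((measurable_logKernel c).div (by fun_prop)).aestronglyMeasurable
    · intro s hs
      refine (ae_restrict_iff' measurableSet_Ioi).2 (ae_of_all _ fun τ (hτ : 0 < τ) => ?_)
      simp only [div_eq_mul_inv, norm_mul, ← mul_add]
      refine mul_le_mul_of_nonneg_left ?_ (norm_nonneg _)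
      have e : ∀ r : ℝ, ‖(τ ^ r)⁻¹‖ = (τ⁻¹) ^ r := fun r => by
        rw [Real.norm_of_nonneg (by positivity), Real.inv_rpow hτ.le]
      rw [e, e, e]
      rcases le_total 1 τ⁻¹ with h | h
      · refine (Real.rpow_le_rpow_of_exponent_le h (?_ : 1 + s ≤ 1 + 1)).trans
          (le_add_of_nonneg_left (by positivity))
        linarith [hs.2]
      · refine (Real.rpow_le_rpow_of_exponent_ge (by positivity) h
          (?_ : 1 + 1 * (2 : ℝ)⁻¹ ≤ 1 + s)).trans (le_add_of_nonneg_right (by positivity))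
        linarith [hs.1]
    · exact (integrableOn_logKernel_div_rpow hc (by norm_num) (by norm_num)).norm.add
        (integrableOn_logKernel_div_rpow hc (by norm_num) (by norm_num)).norm
    · refine (ae_restrict_iff' measurableSet_Ioi).2 (ae_of_all _ fun τ (hτ : 0 < τ) => ?_)
      refine continuousOn_const.div ?_ fun s _ => (Real.rpow_pos_of_pos hτ _).ne'
      exact (Continuous.rpow continuous_const (by fun_prop) fun _ => Or.inl hτ.ne').continuousOn
  refine h.congr fun s hs => ?_
  exact hFun_eq_integral_logKernel hc (by linarith [hs.1]) (by linarith [hs.2])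

theorem exists_isThreshold {c : ℝ} (hc : c ∈ Ioc (1 : ℝ) 2) : ∃ s₀, IsThreshold c s₀ := by
  have hc0 : 0 < c := by linarith [hc.1]
  obtain ⟨s₀, hs, h0⟩ := intermediate_value_Ioo' (by norm_num : (1 / 2 : ℝ) ≤ 1)
    (continuousOn_hFun hc0) ⟨hFun_one_neg hc, hFun_half_pos hc⟩
  have hκ : 0 < min c √2 := lt_min hc0 (by positivity)
  refine ⟨s₀, hs, fun s h => ?_, h0, fun s h => ?_⟩
  · have := rpow_mul_hFun_strictAnti hc.1 (by linarith [h.1]) h.2 (by linarith [hs.2])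
    rw [h0, mul_zero] at this
    exact pos_of_mul_pos_right this (by positivity)
  · have := rpow_mul_hFun_strictAnti hc.1 (by linarith [hs.1]) h.1 (by linarith [h.2])
    rw [h0, mul_zero] at this
    exact neg_of_mul_neg_right this (by positivity)

/-! ### Small powers in place of the logarithm -/

theorem log_le_rpow_sub_one_div {x a : ℝ} (hx : 0 < x) (ha : 0 < a) :
    Real.log x ≤ (x ^ a - 1) / a := by
  rw [le_div_iff₀ ha, mul_comm, ← Real.log_rpow hx]
  exact Real.log_le_sub_one_of_pos (Real.rpow_pos_of_pos hx a)

theorem rpow_sub_one_le {x a : ℝ} (hx : 0 ≤ x) (ha : 0 ≤ a) (ha1 : a ≤ 1) :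
    x ^ a - 1 ≤ a * (x - 1) := by
  have := rpow_one_add_le_one_add_mul_self (s := x - 1) (by linarith) ha ha1
  rw [add_sub_cancel] at this
  linarith

/-- The derivative of `a ↦ x ^ a` at `0`, as a difference quotient. -/
theorem tendsto_rpow_sub_one_div {x : ℝ} (hx : 0 < x) :
    Tendsto (fun a : ℝ => (x ^ a - 1) / a) (𝓝[>] 0) (𝓝 (Real.log x)) := by
  have h := (Real.hasStrictDerivAt_const_rpow hx 0).hasDerivAt.tendsto_slope_zero_right
  simp only [zero_add, Real.rpow_zero, one_mul, smul_eq_mul] at h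
  refine h.congr fun a => ?_
  rw [inv_mul_eq_div]

/-- The bound `min (σ²) (2σ)` for second differences of functions with bounded first and second
derivatives; it is integrable against `σ^(-(1+2s))` for `1/2 < s < 1`. -/
noncomputable def quadLin (σ : ℝ) : ℝ := min (σ ^ 2) (2 * σ)

theorem measurable_quadLin : Measurable quadLin := by
  unfold quadLin
  fun_prop

theorem quadLin_nonneg {σ : ℝ} (h : 0 ≤ σ) : 0 ≤ quadLin σ :=
  le_min (by positivity) (by positivity)

theorem integrableOn_quadLin_div_rpow {s : ℝ} (h1 : 1 / 2 < s) (h2 : s < 1) :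
    IntegrableOn (fun σ : ℝ => quadLin σ / σ ^ (1 + 2 * s)) (Ioi 0) := by
  have hm : ∀ S : Set ℝ, AEStronglyMeasurable (fun σ : ℝ => quadLin σ / σ ^ (1 + 2 * s))
      (volume.restrict S) := fun S =>
    (measurable_quadLin.div (by fun_prop)).aestronglyMeasurable
  rw [← Ioc_union_Ioi_eq_Ioi zero_le_one]
  refine IntegrableOn.union ?_ ?_
  · have hi : IntegrableOn (fun x : ℝ => x ^ (2 - (1 + 2 * s))) (Ioc 0 1) := by
      have := intervalIntegral.intervalIntegrable_rpow' (a := 0) (b := 1)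
        (r := 2 - (1 + 2 * s)) (by linarith)
      rwa [intervalIntegrable_iff_integrableOn_Ioc_of_le (by norm_num)] at this
    refine hi.mono' (hm _) ((ae_restrict_iff' measurableSet_Ioc).2 (ae_of_all _ fun x hx => ?_))
    rw [Real.norm_of_nonneg (div_nonneg (quadLin_nonneg hx.1.le) (Real.rpow_nonneg hx.1.le _)),
      Real.rpow_sub hx.1, Real.rpow_two]
    gcongr
    · exact Real.rpow_nonneg hx.1.le _
    · exact min_le_left _ _
  · have hi : IntegrableOn (fun x : ℝ => 2 * x ^ (1 - (1 + 2 * s))) (Ioi 1) :=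
      (integrableOn_Ioi_rpow_of_lt (by linarith) one_pos).const_mul _
    refine hi.mono' (hm _) ((ae_restrict_iff' measurableSet_Ioi).2
      (ae_of_all _ fun x (hx : 1 < x) => ?_))
    have hx0 : 0 < x := by linarith
    rw [Real.norm_of_nonneg (div_nonneg (quadLin_nonneg hx0.le) (Real.rpow_nonneg hx0.le _)),
      Real.rpow_sub hx0, Real.rpow_one, ← mul_div_assoc]
    gcongr
    exact min_le_right _ _

/-- The second difference of `|z|^α` at a unit vector along increments of length `σ` orthogonal to
it: the largest among all directions. -/
noncomputable def orthGain (α σ : ℝ) : ℝ := 2 * ((1 + σ ^ 2) ^ (α / 2) - 1)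

/-- The second difference of `|z|^α` at a unit vector `z` along increments `±σ z`, cut off
at `σ² = c`. -/
noncomputable def radialGain (c α σ : ℝ) : ℝ :=
  if σ ^ 2 < c then (1 + σ) ^ α + |1 - σ| ^ α - 2 else 0

theorem measurable_orthGain (α : ℝ) : Measurable (orthGain α) := by
  unfold orthGain
  fun_prop

theorem measurable_radialGain (c α : ℝ) : Measurable (radialGain c α) := by
  unfold radialGain
  exact Measurable.ite (measurableSet_lt (by fun_prop) (by fun_prop)) (by fun_prop) (by fun_prop)

theorem orthGain_nonneg {α : ℝ} (ha : 0 ≤ α) (σ : ℝ) : 0 ≤ orthGain α σ := by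
  have := Real.one_le_rpow (x := 1 + σ ^ 2) (z := α / 2) (by nlinarith [sq_nonneg σ]) (by linarith)
  unfold orthGain
  linarith

theorem orthGain_le {α σ : ℝ} (ha : 0 ≤ α) (ha1 : α ≤ 1) (hσ : 0 ≤ σ) :
    orthGain α σ ≤ α * quadLin σ := by
  rw [quadLin, mul_min_of_nonneg _ _ ha, orthGain]
  refine le_min ?_ ?_
  · have := rpow_sub_one_le (x := 1 + σ ^ 2) (a := α / 2) (by positivity) (by linarith) (by linarith)
    linarith
  · have h := rpow_sub_one_le (x := √(1 + σ ^ 2)) (a := α) (by positivity) ha ha1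
    have h2 : √(1 + σ ^ 2) ≤ 1 + σ := Real.sqrt_le_iff.2 ⟨by linarith, by nlinarith⟩
    rw [Real.sqrt_eq_rpow, ← Real.rpow_mul (by positivity), ← Real.sqrt_eq_rpow] at h
    rw [show α / 2 = 1 / 2 * α by ring]
    nlinarith [mul_le_mul_of_nonneg_left h2 ha]

/-- The point `σ = 1` is excluded because there `log 0 = 0` is not a lower bound. -/
theorem abs_radialGain_le {c α σ : ℝ} (ha : 0 < α) (ha1 : α ≤ 1) (hσ : 0 < σ) (h1 : σ ≠ 1) :
    |radialGain c α σ| ≤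
      α * (if σ ^ 2 < c then |Real.log (1 - σ ^ 2)| + σ ^ 2 else 0) := by
  rw [radialGain]
  split_ifs with h
  swap
  · simp
  have hpos : 0 < |1 - σ| := abs_pos.2 (sub_ne_zero.2 h1.symm)
  have l1 := log_le_rpow_sub_one_div (x := 1 + σ) (by linarith) ha
  have l2 := log_le_rpow_sub_one_div hpos ha
  rw [le_div_iff₀ ha] at l1 l2
  have u1 := rpow_sub_one_le (x := 1 + σ) (by linarith) ha.le ha1
  have u2 := rpow_sub_one_le hpos.le ha.le ha1
  have e : Real.log (1 - σ ^ 2) = Real.log (1 + σ) + Real.log |1 - σ| := by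
    rw [Real.log_abs, ← Real.log_mul (by linarith) (sub_ne_zero.2 h1.symm)]
    congr 1
    ring
  have hu : (1 + σ - 1) + (|1 - σ| - 1) ≤ σ ^ 2 := by
    rcases abs_cases (1 - σ) with ⟨h, -⟩ | ⟨h, -⟩ <;> rw [h] <;> nlinarith [sq_nonneg (σ - 1)]
  have hlog := neg_abs_le (Real.log (1 - σ ^ 2))
  have hlog' := abs_nonneg (Real.log (1 - σ ^ 2))
  have m1 := mul_le_mul_of_nonneg_left hu ha.le
  have m2 := mul_le_mul_of_nonneg_left hlog ha.le
  have m3 := mul_nonneg ha.le hlog'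
  have m4 := mul_nonneg ha.le (sq_nonneg σ)
  rw [e] at m2 m3 ⊢
  rw [abs_le]
  constructor <;> nlinarith

theorem integrableOn_orthGain_div_rpow {s α : ℝ} (h1 : 1 / 2 < s) (h2 : s < 1) (ha : 0 ≤ α)
    (ha1 : α ≤ 1) : IntegrableOn (fun σ : ℝ => orthGain α σ / σ ^ (1 + 2 * s)) (Ioi 0) := by
  refine ((integrableOn_quadLin_div_rpow h1 h2).const_mul α).mono'
    ((measurable_orthGain α).div (by fun_prop)).aestronglyMeasurable
    ((ae_restrict_iff' measurableSet_Ioi).2 (ae_of_all _ fun x (hx : 0 < x) => ?_))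
  rw [Real.norm_of_nonneg (div_nonneg (orthGain_nonneg ha x) (Real.rpow_nonneg hx.le _)),
    ← mul_div_assoc]
  gcongr
  exact orthGain_le ha ha1 hx.le

theorem integrableOn_radialGain_bound {c s : ℝ} (hc : 0 < c) (h2 : s < 1) :
    IntegrableOn (fun σ : ℝ => (if σ ^ 2 < c then |Real.log (1 - σ ^ 2)| + σ ^ 2 else 0) /
      σ ^ (1 + 2 * s)) (Ioi 0) := by
  have hpow : IntegrableOn (fun x : ℝ => x ^ (2 - (1 + 2 * s))) (Ioo 0 √c) := by
    have := intervalIntegral.intervalIntegrable_rpow' (a := 0) (b := √c)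
      (r := 2 - (1 + 2 * s)) (by linarith)
    rwa [intervalIntegrable_iff_integrableOn_Ioo_of_le (by positivity)] at this
  rw [← Ioo_union_Ici_eq_Ioi (Real.sqrt_pos.2 hc)]
  refine IntegrableOn.union ?_ ?_
  · have hi := (integrableOn_log_abs_one_sub_sq_div_rpow (p := 1 + 2 * s) (b := √c)
      (by linarith)).norm.add hpow
    refine IntegrableOn.congr_fun hi (fun x hx => ?_) measurableSet_Ioo
    have hxc : x ^ 2 < c := (Real.lt_sqrt hx.1.le).1 hx.2
    simp only [Pi.add_apply, if_pos hxc]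
    rw [norm_div, Real.norm_of_nonneg (Real.rpow_nonneg hx.1.le _), Real.rpow_sub hx.1,
      Real.rpow_two, ← add_div, Real.norm_eq_abs, Real.log_abs]
  · refine integrableOn_zero.congr_fun (fun x (hx : √c ≤ x) => ?_) measurableSet_Ici
    have hxc : ¬ x ^ 2 < c := not_lt.2 ((Real.sqrt_le_left ((Real.sqrt_nonneg c).trans hx)).1 hx)
    simp [hxc]

theorem integrableOn_radialGain_div_rpow {c s α : ℝ} (hc : 0 < c) (h2 : s < 1) (ha : 0 < α)
    (ha1 : α ≤ 1) : IntegrableOn (fun σ : ℝ => radialGain c α σ / σ ^ (1 + 2 * s)) (Ioi 0) := by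
  have h1ae : ∀ᵐ x : ℝ, x ≠ 1 := by simp [ae_iff]
  refine ((integrableOn_radialGain_bound hc h2).const_mul α).mono'
    ((measurable_radialGain c α).div (by fun_prop)).aestronglyMeasurable
    ((ae_restrict_iff' measurableSet_Ioi).2 (h1ae.mono fun x hx1 (hx : 0 < x) => ?_))
  rw [norm_div, Real.norm_of_nonneg (Real.rpow_nonneg hx.le _), ← mul_div_assoc, Real.norm_eq_abs]
  gcongr
  exact abs_radialGain_le ha ha1 hx hx1

theorem tendsto_gain_div {c σ : ℝ} (hσ : 0 < σ) (h1 : σ ≠ 1) :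
    Tendsto (fun α : ℝ => (orthGain α σ + radialGain c α σ) / α) (𝓝[>] 0)
      (𝓝 (logKernel c (σ ^ 2))) := by
  have ho : Tendsto (fun α : ℝ => orthGain α σ / α) (𝓝[>] 0) (𝓝 (Real.log (1 + σ ^ 2))) := by
    have h2 : Tendsto (fun α : ℝ => α / 2) (𝓝[>] 0) (𝓝[>] 0) := by
      refine tendsto_nhdsWithin_iff.2 ⟨?_, ?_⟩
      · refine Tendsto.mono_left ?_ nhdsWithin_le_nhds
        simpa using (continuous_id.div_const (2 : ℝ)).tendsto 0
      · filter_upwards [self_mem_nhdsWithin] with a (ha : 0 < a)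
        exact half_pos ha
    refine ((tendsto_rpow_sub_one_div (x := 1 + σ ^ 2) (by positivity)).comp h2).congr fun a => ?_
    simp only [Function.comp, orthGain]
    rw [div_div_eq_mul_div, mul_comm]
  have hr : Tendsto (fun α : ℝ => radialGain c α σ / α) (𝓝[>] 0)
      (𝓝 (if σ ^ 2 < c then Real.log (1 + σ) + Real.log |1 - σ| else 0)) := by
    unfold radialGain
    split_ifs with h
    · refine ((tendsto_rpow_sub_one_div (x := 1 + σ) (by linarith)).add
        (tendsto_rpow_sub_one_div (abs_pos.2 (sub_ne_zero.2 h1.symm)))).congr fun a => ?_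
      rw [← add_div]
      congr 1
      ring
    · simp
  have hlim : Real.log (1 + σ ^ 2) +
      (if σ ^ 2 < c then Real.log (1 + σ) + Real.log |1 - σ| else 0) = logKernel c (σ ^ 2) := by
    unfold logKernel
    split_ifs with h
    · have hne : 1 - σ ≠ 0 := sub_ne_zero.2 h1.symm
      rw [Real.log_abs, Real.log_abs, ← Real.log_mul (by linarith) hne,
        ← Real.log_mul (by positivity) (mul_ne_zero (by linarith) hne)]
      congr 1
      ring
    · simp
  rw [← hlim]
  refine (ho.add hr).congr fun a => ?_
  rw [add_div]

/-- The substitution `τ = σ²`. -/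
theorem integral_logKernel_sq {c s : ℝ} (hc : 0 < c) (h0 : 0 < s) (h2 : s < 2) :
    2 * ∫ σ in Ioi (0 : ℝ), logKernel c (σ ^ 2) / σ ^ (1 + 2 * s) = hFun c s := by
  rw [hFun_eq_integral_logKernel hc h0 h2, ← integral_const_mul,
    ← integral_comp_rpow_Ioi_of_pos (g := fun τ => logKernel c τ / τ ^ (1 + s)) (p := 2)
      (by norm_num)]
  refine setIntegral_congr_fun measurableSet_Ioi fun x (hx : 0 < x) => ?_
  have e : (x ^ (2 : ℝ)) ^ (1 + s) = x * x ^ (1 + 2 * s) := by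
    rw [← Real.rpow_mul hx.le, ← Real.rpow_one_add' hx.le (by linarith)]
    congr 1
    ring
  simp only [smul_eq_mul]
  rw [e, Real.rpow_two, show (2 - 1 : ℝ) = 1 by norm_num, Real.rpow_one]
  field_simp

/-- Where `h_c` is negative, so is the total gain for a small power: after division by `α` it
converges to `h_c(s) / 2` as `α → 0`. -/
theorem exists_integral_gain_neg {c s : ℝ} (hc : 0 < c) (h1 : 1 / 2 < s) (h2 : s < 1)
    (hneg : hFun c s < 0) :
    ∃ α : ℝ, 0 < α ∧ α ≤ 1 ∧
      ∫ σ in Ioi (0 : ℝ), (orthGain α σ + radialGain c α σ) / σ ^ (1 + 2 * s) < 0 := by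
  have h1ae : ∀ᵐ x : ℝ, x ≠ 1 := by simp [ae_iff]
  have hsmall : ∀ᶠ α : ℝ in 𝓝[>] 0, 0 < α ∧ α ≤ 1 := by
    filter_upwards [Ioc_mem_nhdsGT (zero_lt_one (α := ℝ))] with α hα using hα
  have hlim : Tendsto (fun α : ℝ => ∫ σ in Ioi (0 : ℝ),
      (orthGain α σ + radialGain c α σ) / α / σ ^ (1 + 2 * s)) (𝓝[>] 0)
      (𝓝 (∫ σ in Ioi (0 : ℝ), logKernel c (σ ^ 2) / σ ^ (1 + 2 * s))) := by
    refine tendsto_integral_filter_of_dominated_convergence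
      (fun σ => quadLin σ / σ ^ (1 + 2 * s) +
        (if σ ^ 2 < c then |Real.log (1 - σ ^ 2)| + σ ^ 2 else 0) / σ ^ (1 + 2 * s)) ?_ ?_
      ((integrableOn_quadLin_div_rpow h1 h2).add (integrableOn_radialGain_bound hc h2)) ?_
    · refine Eventually.of_forall fun α => Measurable.aestronglyMeasurable ?_
      exact (((measurable_orthGain α).add (measurable_radialGain c α)).div_const α).div
        (by fun_prop)
    · filter_upwards [hsmall] with α hα
      refine (ae_restrict_iff' measurableSet_Ioi).2 (h1ae.mono fun x hx1 (hx : 0 < x) => ?_)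
      rw [norm_div, norm_div, Real.norm_of_nonneg (Real.rpow_nonneg hx.le _), ← add_div,
        Real.norm_of_nonneg hα.1.le]
      refine div_le_div_of_nonneg_right ?_ (Real.rpow_nonneg hx.le _)
      rw [div_le_iff₀ hα.1, mul_comm, mul_add, Real.norm_eq_abs]
      refine (abs_add_le _ _).trans (add_le_add ?_ (abs_radialGain_le hα.1 hα.2 hx hx1))
      rw [abs_of_nonneg (orthGain_nonneg hα.1.le x)]
      exact orthGain_le hα.1.le hα.2 hx.le
    · refine (ae_restrict_iff' measurableSet_Ioi).2 (h1ae.mono fun x hx1 (hx : 0 < x) => ?_)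
      exact (tendsto_gain_div hx hx1).div_const _
  have hlt : ∫ σ in Ioi (0 : ℝ), logKernel c (σ ^ 2) / σ ^ (1 + 2 * s) < 0 := by
    have := integral_logKernel_sq hc (s := s) (by linarith) (by linarith)
    linarith
  obtain ⟨α, hα, hI⟩ := (hsmall.and (hlim.eventually_lt_const hlt)).exists
  refine ⟨α, hα.1, hα.2, ?_⟩
  have e : ∀ σ : ℝ, (orthGain α σ + radialGain c α σ) / α / σ ^ (1 + 2 * s) =
      (orthGain α σ + radialGain c α σ) / σ ^ (1 + 2 * s) / α := fun σ => div_right_comm _ _ _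
  simp only [e, integral_div] at hI
  by_contra! h
  exact absurd hI (not_lt.2 (div_nonneg h hα.1.le))

theorem comp_mul_div_rpow (f : ℝ → ℝ) {k t p : ℝ} (hk : 0 < k) (ht : 0 < t) :
    f (k * t) / t ^ p = k ^ p * (f (k * t) / (k * t) ^ p) := by
  have := Real.rpow_pos_of_pos hk p
  have := Real.rpow_pos_of_pos ht p
  rw [Real.mul_rpow hk.le ht.le]
  field_simp

theorem integral_comp_mul_div_rpow (f : ℝ → ℝ) {k : ℝ} (p : ℝ) (hk : 0 < k) :
    ∫ t in Ioi (0 : ℝ), f (k * t) / t ^ p = k ^ (p - 1) * ∫ t in Ioi (0 : ℝ), f t / t ^ p := by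
  rw [setIntegral_congr_fun measurableSet_Ioi fun t ht => comp_mul_div_rpow f (p := p) hk ht,
    integral_const_mul, integral_comp_mul_left_Ioi (fun t => f t / t ^ p) 0 hk, mul_zero,
    smul_eq_mul, Real.rpow_sub_one hk.ne']
  ring

theorem IntegrableOn.comp_mul_div_rpow {f : ℝ → ℝ} {k p : ℝ} (hk : 0 < k)
    (hf : IntegrableOn (fun t => f t / t ^ p) (Ioi 0)) :
    IntegrableOn (fun t => f (k * t) / t ^ p) (Ioi 0) := by
  have h := ((integrableOn_Ioi_comp_mul_left_iff (fun t => f t / t ^ p) 0 hk).2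
    (by rwa [mul_zero])).const_mul (k ^ p)
  exact IntegrableOn.congr_fun h (fun t ht => (_root_.comp_mul_div_rpow f hk ht).symm)
    measurableSet_Ioi

/-! ### Second differences at a maximum of the doubled function -/

/-- The coercive smooth penalization `√(1 + |x|²)`. -/
noncomputable def penalty {N : ℕ} (x : RN N) : ℝ := √(1 + ‖x‖ ^ 2)

theorem contDiff_penalty {N : ℕ} : ContDiff ℝ 2 (penalty (N := N)) := by
  unfold penalty
  exact ContDiff.sqrt (contDiff_const.add (contDiff_id.norm_sq ℝ)) fun x => by positivity

theorem penalty_nonneg {N : ℕ} (x : RN N) : 0 ≤ penalty x := Real.sqrt_nonneg _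

theorem norm_le_penalty {N : ℕ} (x : RN N) : ‖x‖ ≤ penalty x :=
  Real.le_sqrt_of_sq_le (by linarith)

theorem norm_add_sq_add_norm_sub_sq {N : ℕ} (x h : RN N) :
    ‖x + h‖ ^ 2 + ‖x - h‖ ^ 2 = 2 * (‖x‖ ^ 2 + ‖h‖ ^ 2) := by
  have := parallelogram_law_with_norm ℝ x h
  linarith

theorem secondDiff_penalty_le {N : ℕ} (x h : RN N) : secondDiff penalty x h ≤ quadLin ‖h‖ := by
  have hp := norm_add_sq_add_norm_sub_sq x h
  set t := ‖h‖ with ht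
  have ht0 : 0 ≤ t := norm_nonneg h
  simp only [secondDiff, penalty, quadLin]
  set P := √(1 + ‖x + h‖ ^ 2) with hP
  set Q := √(1 + ‖x - h‖ ^ 2) with hQ
  set A := √(1 + ‖x‖ ^ 2) with hA
  have hP2 : P ^ 2 = 1 + ‖x + h‖ ^ 2 := Real.sq_sqrt (by positivity)
  have hQ2 : Q ^ 2 = 1 + ‖x - h‖ ^ 2 := Real.sq_sqrt (by positivity)
  have hA2 : A ^ 2 = 1 + ‖x‖ ^ 2 := Real.sq_sqrt (by positivity)
  have hA1 : 1 ≤ A := Real.one_le_sqrt.2 (by nlinarith [sq_nonneg ‖x‖])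
  have hPQ : (P + Q) ^ 2 ≤ 4 * (A ^ 2 + t ^ 2) := by nlinarith [sq_nonneg (P - Q)]
  refine le_min ?_ ?_
  · have : P + Q ≤ 2 * A + t ^ 2 := by
      refine abs_le_of_sq_le_sq' ?_ (by positivity) |>.2
      nlinarith [mul_nonneg (sub_nonneg.2 hA1) (sq_nonneg t), sq_nonneg (t ^ 2)]
    linarith
  · have : P + Q ≤ 2 * A + 2 * t := by
      refine abs_le_of_sq_le_sq' ?_ (by positivity) |>.2
      nlinarith [mul_nonneg (by linarith : 0 ≤ A) ht0]
    linarith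

theorem norm_add_rpow_add_norm_sub_rpow_le {N : ℕ} {α : ℝ} (ha : 0 ≤ α) (ha2 : α ≤ 2)
    (z w : RN N) : ‖z + w‖ ^ α + ‖z - w‖ ^ α ≤ 2 * (‖z‖ ^ 2 + ‖w‖ ^ 2) ^ (α / 2) := by
  have hmem : ∀ v : RN N, ‖v‖ ^ 2 ∈ Ici (0 : ℝ) := fun v => mem_Ici.2 (by positivity)
  have h := (Real.concaveOn_rpow (p := α / 2) (by linarith) (by linarith)).2
    (hmem (z + w)) (hmem (z - w)) (by norm_num : (0 : ℝ) ≤ 1 / 2) (by norm_num : (0 : ℝ) ≤ 1 / 2)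
    (by norm_num)
  have e : ∀ v : RN N, (‖v‖ ^ 2) ^ (α / 2) = ‖v‖ ^ α := fun v => by
    rw [← Real.rpow_natCast_mul (norm_nonneg v)]
    congr 1
    push_cast
    ring
  simp only [smul_eq_mul, e] at h
  rw [← mul_add, ← mul_add, norm_add_sq_add_norm_sub_sq, ← mul_assoc] at h
  norm_num at h
  linarith

/-- The parallelogram law and concavity of `x ^ (α/2)` bound the gain in an arbitrary direction by
the one in an orthogonal direction, of the maximal length `‖t(ξ - η)‖ = 2t`. -/
theorem norm_add_smul_sub_rpow_le {N : ℕ} {α r t : ℝ} (ha : 0 ≤ α) (ha2 : α ≤ 2) (hr : 0 < r)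
    (ht : 0 ≤ t) {z ξ η : RN N} (hz : ‖z‖ = r) (hξ : ‖ξ‖ = 1) (hη : ‖η‖ = 1) :
    ‖z + t • (ξ - η)‖ ^ α + ‖z - t • (ξ - η)‖ ^ α - 2 * r ^ α ≤
      r ^ α * orthGain α (2 / r * t) := by
  have hw : ‖t • (ξ - η)‖ ≤ 2 * t := by
    rw [norm_smul, Real.norm_of_nonneg ht, mul_comm]
    have := norm_sub_le ξ η
    gcongr
    linarith
  have e : r ^ 2 + (2 * t) ^ 2 = r ^ 2 * (1 + (2 / r * t) ^ 2) := by
    field_simp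
  have h2 : (‖z‖ ^ 2 + ‖t • (ξ - η)‖ ^ 2) ^ (α / 2) ≤
      r ^ α * (1 + (2 / r * t) ^ 2) ^ (α / 2) := by
    rw [hz]
    calc (r ^ 2 + ‖t • (ξ - η)‖ ^ 2) ^ (α / 2) ≤ (r ^ 2 + (2 * t) ^ 2) ^ (α / 2) := by gcongr
      _ = _ := by
        rw [e, Real.mul_rpow (by positivity) (by positivity), ← Real.rpow_natCast_mul hr.le]
        congr 2
        push_cast
        ring
  have h1 := norm_add_rpow_add_norm_sub_rpow_le ha ha2 z (t • (ξ - η))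
  rw [orthGain]
  linarith

/-- The property of a maximum point `(x, y)` of `u(p) - u(q) - ε |p - q|^α - β √(1 + |p|²)`. -/
def IsDoublingMax {N : ℕ} (α ε β : ℝ) (u : RN N → ℝ) (x y : RN N) : Prop :=
  ∀ p q, u p - u q ≤ u x - u y + ε * (‖p - q‖ ^ α - ‖x - y‖ ^ α) + β * (penalty p - penalty x)

/-- Pairing `x ± tξ` with `y ± tη`. -/
theorem IsDoublingMax.secondDiff_sub_le {N : ℕ} {α ε β t : ℝ} {u : RN N → ℝ} {x y ξ η : RN N}
    (H : IsDoublingMax α ε β u x y) (ha : 0 ≤ α) (ha2 : α ≤ 2) (hε : 0 ≤ ε) (hβ : 0 ≤ β)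
    (hxy : 0 < ‖x - y‖) (ht : 0 ≤ t) (hξ : ‖ξ‖ = 1) (hη : ‖η‖ = 1) :
    secondDiff u x (t • ξ) - secondDiff u y (t • η) ≤
      ε * ‖x - y‖ ^ α * orthGain α (2 / ‖x - y‖ * t) + β * quadLin t := by
  have h1 := H (x + t • ξ) (y + t • η)
  have h2 := H (x - t • ξ) (y - t • η)
  have h3 := secondDiff_penalty_le x (t • ξ)
  rw [norm_smul, hξ, mul_one, Real.norm_of_nonneg ht] at h3
  have h4 := norm_add_smul_sub_rpow_le ha ha2 hxy ht (z := x - y) rfl hξ hη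
  rw [show x + t • ξ - (y + t • η) = x - y + t • (ξ - η) by rw [smul_sub]; abel] at h1
  rw [show x - t • ξ - (y - t • η) = x - y - t • (ξ - η) by rw [smul_sub]; abel] at h2
  have h5 := mul_le_mul_of_nonneg_left h4 hε
  have h6 := mul_le_mul_of_nonneg_left h3 hβ
  simp only [secondDiff] at h6 ⊢
  linarith

/-- In the direction `e` of `x - y`, pairing `x ± te` with `y ∓ te` for short increments and with
`y ± te` for long ones. -/
theorem IsDoublingMax.secondDiff_radial_sub_le {N : ℕ} {α ε β t : ℝ} {u : RN N → ℝ}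
    {x y : RN N} (c : ℝ) (H : IsDoublingMax α ε β u x y) (hβ : 0 ≤ β)
    (hxy : 0 < ‖x - y‖) (ht : 0 ≤ t) :
    secondDiff u x (t • ‖x - y‖⁻¹ • (x - y)) - secondDiff u y (t • ‖x - y‖⁻¹ • (x - y)) ≤
      ε * ‖x - y‖ ^ α * radialGain c α (2 / ‖x - y‖ * t) + β * quadLin t := by
  set r := ‖x - y‖ with hr
  set e := r⁻¹ • (x - y) with he
  have hen : ‖e‖ = 1 := by
    rw [he, norm_smul, norm_inv, norm_norm, ← hr, inv_mul_cancel₀ hxy.ne']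
  have h3 := secondDiff_penalty_le x (t • e)
  rw [norm_smul, hen, mul_one, Real.norm_of_nonneg ht] at h3
  have h6 := mul_le_mul_of_nonneg_left h3 hβ
  rw [radialGain]
  split_ifs with hc
  · have h1 := H (x + t • e) (y - t • e)
    have h2 := H (x - t • e) (y + t • e)
    have hte : t • e = (t / r) • (x - y) := by rw [he, smul_smul, div_eq_mul_inv]
    have e1 : x + t • e - (y - t • e) = (1 + 2 / r * t) • (x - y) := by
      rw [hte]
      module
    have e2 : x - t • e - (y + t • e) = (1 - 2 / r * t) • (x - y) := by
      rw [hte]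
      module
    have hσ : 0 ≤ 2 / r * t := by positivity
    rw [e1, norm_smul, Real.norm_of_nonneg (by positivity), ← hr,
      Real.mul_rpow (by positivity) hxy.le] at h1
    rw [e2, norm_smul, Real.norm_eq_abs, ← hr, Real.mul_rpow (by positivity) hxy.le] at h2
    simp only [secondDiff] at h6 ⊢
    linarith
  · have h1 := H (x + t • e) (y + t • e)
    have h2 := H (x - t • e) (y - t • e)
    rw [add_sub_add_right_eq_sub] at h1
    rw [sub_sub_sub_cancel_right] at h2
    simp only [secondDiff] at h6 ⊢
    linarith

/-! ### The operator on glued functions -/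

/-- Second differences of a `C²` function are locally quadratic. -/
theorem ContDiffAt.exists_secondDiff_le {N : ℕ} {φ : RN N → ℝ} {x : RN N}
    (h : ContDiffAt ℝ 2 φ x) :
    ∃ A : ℝ, 0 ≤ A ∧ ∃ δ > 0, ∀ v : RN N, ‖v‖ ≤ δ → |secondDiff φ x v| ≤ A * ‖v‖ ^ 2 := by
  have hd : ContDiffAt ℝ 1 (fderiv ℝ φ) x := h.fderiv_right (by norm_num)
  obtain ⟨K, T, hT, hK⟩ := hd.exists_lipschitzOnWith
  have hdiff : ∀ᶠ p in 𝓝 x, DifferentiableAt ℝ φ p :=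
    (h.eventually (by simp)).mono fun p hp => hp.differentiableAt (by norm_num)
  obtain ⟨δ, hδ, hball⟩ := Metric.nhds_basis_closedBall.mem_iff.1 (Filter.inter_mem hT hdiff)
  refine ⟨K * 2, by positivity, δ, hδ, fun v hv => ?_⟩
  have hmem : ∀ w ∈ Metric.closedBall (0 : RN N) ‖v‖, x + w ∈ T ∩ {p | DifferentiableAt ℝ φ p} ∧
      x - w ∈ T ∩ {p | DifferentiableAt ℝ φ p} := fun w hw => by
    rw [mem_closedBall_zero_iff] at hw
    constructor <;> refine hball ?_ <;> rw [mem_closedBall_iff_norm] <;> simpa using hw.trans hv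
  have hder : ∀ w ∈ Metric.closedBall (0 : RN N) ‖v‖,
      HasFDerivWithinAt (fun w => φ (x + w) + φ (x - w))
        (fderiv ℝ φ (x + w) - fderiv ℝ φ (x - w)) (Metric.closedBall (0 : RN N) ‖v‖) w := by
    intro w hw
    obtain ⟨⟨-, h1⟩, ⟨-, h2⟩⟩ := hmem w hw
    have d1 := h1.hasFDerivAt.comp w ((hasFDerivAt_id w).const_add x)
    have d2 := h2.hasFDerivAt.comp w ((hasFDerivAt_id w).const_sub x)
    refine ((d1.add d2).congr_fderiv ?_).hasFDerivWithinAt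
    ext y
    simp [sub_eq_add_neg]
  have hbd : ∀ w ∈ Metric.closedBall (0 : RN N) ‖v‖,
      ‖fderiv ℝ φ (x + w) - fderiv ℝ φ (x - w)‖ ≤ K * 2 * ‖v‖ := by
    intro w hw
    obtain ⟨⟨h1, -⟩, ⟨h2, -⟩⟩ := hmem w hw
    have := hK.norm_sub_le h1 h2
    rw [mem_closedBall_zero_iff] at hw
    rw [show x + w - (x - w) = (2 : ℝ) • w by rw [two_smul]; abel, norm_smul,
      Real.norm_two] at this
    refine this.trans ?_
    rw [mul_assoc]
    gcongr
  have := (convex_closedBall (0 : RN N) ‖v‖).norm_image_sub_le_of_norm_hasFDerivWithin_le hder hbd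
    (Metric.mem_closedBall_self (norm_nonneg v)) (by simp : v ∈ Metric.closedBall (0 : RN N) ‖v‖)
  simp only [add_zero, sub_zero] at this
  rw [secondDiff, ← Real.norm_eq_abs]
  calc ‖φ (x + v) + φ (x - v) - 2 * φ x‖ = ‖φ (x + v) + φ (x - v) - (φ x + φ x)‖ := by
        rw [two_mul]
    _ ≤ K * 2 * ‖v‖ * ‖v‖ := this
    _ = _ := by ring

theorem secondDiff_glue {N : ℕ} {φ u : RN N → ℝ} {x : RN N} {ρ : ℝ} (hρ : 0 ≤ ρ)
    (hx : u x = φ x) (v : RN N) :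
    secondDiff (glue φ u x ρ) x v = if ‖v‖ ≤ ρ then secondDiff φ x v else secondDiff u x v := by
  simp only [secondDiff, glue, mem_closedBall_iff_norm, add_sub_cancel_left, sub_self, norm_zero,
    hρ, if_true, sub_sub_cancel_left, norm_neg]
  split_ifs <;> simp [hx]

theorem abs_secondDiff_le {N : ℕ} {u : RN N → ℝ} {K : ℝ} (hK : ∀ x, |u x| ≤ K) (x v : RN N) :
    |secondDiff u x v| ≤ 4 * K := by
  have h1 := abs_le.1 (hK (x + v))
  have h2 := abs_le.1 (hK (x - v))
  have h3 := abs_le.1 (hK x)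
  rw [secondDiff, abs_le]
  constructor <;> linarith

theorem integrableOn_glue_bound {s ρ : ℝ} (A B : ℝ) (h0 : 0 < s) (h1 : s < 1) (hρ : 0 < ρ) :
    IntegrableOn (fun τ : ℝ => (if τ ≤ ρ then A * τ ^ 2 else B) / τ ^ (1 + 2 * s)) (Ioi 0) := by
  rw [← Ioc_union_Ioi_eq_Ioi hρ.le]
  refine IntegrableOn.union ?_ ?_
  · have hi := (intervalIntegral.intervalIntegrable_rpow' (a := 0) (b := ρ)
      (r := 2 - (1 + 2 * s)) (by linarith)).const_mul A
    rw [intervalIntegrable_iff_integrableOn_Ioc_of_le hρ.le] at hi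
    refine hi.congr_fun (fun τ hτ => ?_) measurableSet_Ioc
    simp only [if_pos hτ.2]
    rw [Real.rpow_sub hτ.1, Real.rpow_two, mul_div_assoc]
  · have hi : IntegrableOn (fun x : ℝ => B * x ^ (-(1 + 2 * s))) (Ioi ρ) :=
      (integrableOn_Ioi_rpow_of_lt (by linarith) hρ).const_mul _
    refine hi.congr_fun (fun τ (hτ : ρ < τ) => ?_) measurableSet_Ioi
    simp only [if_neg (not_le.2 hτ)]
    rw [Real.rpow_neg (hρ.trans hτ).le, div_eq_mul_inv]

section Glue

variable {N : ℕ} {φ u : RN N → ℝ} {x : RN N} {s ρ A K : ℝ}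

theorem abs_secondDiff_glue_div_le (hρ : 0 ≤ ρ) (hx : u x = φ x) (hK : ∀ x, |u x| ≤ K)
    (hA : ∀ v : RN N, ‖v‖ ≤ ρ → |secondDiff φ x v| ≤ A * ‖v‖ ^ 2) {ξ : RN N} (hξ : ‖ξ‖ = 1)
    {τ : ℝ} (hτ : 0 < τ) :
    |secondDiff (glue φ u x ρ) x (τ • ξ) / τ ^ (1 + 2 * s)| ≤
      (if τ ≤ ρ then A * τ ^ 2 else 4 * K) / τ ^ (1 + 2 * s) := by
  have hn : ‖τ • ξ‖ = τ := by rw [norm_smul, hξ, mul_one, Real.norm_of_nonneg hτ.le]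
  have hp := Real.rpow_pos_of_pos hτ (1 + 2 * s)
  rw [abs_div, abs_of_pos hp, secondDiff_glue hρ hx, hn]
  refine div_le_div_of_nonneg_right ?_ hp.le
  split_ifs with h
  · simpa [hn] using hA (τ • ξ) (hn.trans_le h)
  · exact abs_secondDiff_le hK _ _

theorem integrableOn_secondDiff_glue (h0 : 0 < s) (h1 : s < 1) (hρ : 0 < ρ) (hx : u x = φ x)
    (hu : Continuous u) (hφ : Continuous φ) (hK : ∀ x, |u x| ≤ K)
    (hA : ∀ v : RN N, ‖v‖ ≤ ρ → |secondDiff φ x v| ≤ A * ‖v‖ ^ 2) {ξ : RN N} (hξ : ‖ξ‖ = 1) :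
    IntegrableOn (fun τ : ℝ => secondDiff (glue φ u x ρ) x (τ • ξ) / τ ^ (1 + 2 * s))
      (Ioi 0) := by
  refine (integrableOn_glue_bound A (4 * K) h0 h1 hρ).mono' ?_
    ((ae_restrict_iff' measurableSet_Ioi).2 (ae_of_all _ fun τ hτ =>
      abs_secondDiff_glue_div_le hρ.le hx hK hA hξ hτ))
  refine (Measurable.div ?_ (by fun_prop)).aestronglyMeasurable
  simp only [secondDiff_glue hρ.le hx]
  refine Measurable.ite (measurableSet_le (by fun_prop) measurable_const) ?_ ?_ <;>
  · refine Continuous.measurable ?_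
    unfold secondDiff
    fun_prop

theorem abs_dirOp_glue_le {C : ℝ} (hC : 0 ≤ C) (h0 : 0 < s) (h1 : s < 1) (hρ : 0 < ρ)
    (hx : u x = φ x) (hK : ∀ x, |u x| ≤ K)
    (hA : ∀ v : RN N, ‖v‖ ≤ ρ → |secondDiff φ x v| ≤ A * ‖v‖ ^ 2) {ξ : RN N} (hξ : ‖ξ‖ = 1) :
    |dirOp C s ξ (glue φ u x ρ) x| ≤
      C * ∫ τ in Ioi (0 : ℝ), (if τ ≤ ρ then A * τ ^ 2 else 4 * K) / τ ^ (1 + 2 * s) := by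
  rw [dirOp, abs_mul, abs_of_nonneg hC]
  refine mul_le_mul_of_nonneg_left ?_ hC
  rw [← Real.norm_eq_abs]
  refine norm_integral_le_of_norm_le (integrableOn_glue_bound A (4 * K) h0 h1 hρ)
    ((ae_restrict_iff' measurableSet_Ioi).2 (ae_of_all _ fun τ hτ => ?_))
  exact abs_secondDiff_glue_div_le hρ.le hx hK hA hξ hτ

end Glue

/-- The difference of two values of the operator is controlled through pairs of directions: the
supremum at one point against the infimum at the other with arbitrary directions, and the infimum
at the one against the supremum at the other with a common direction of our choice. -/
theorem nonneg_of_inf_add_sup {ι : Type*} {F G : ι → ℝ} {B₁ B₂ : ℝ} (i₀ : ι)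
    (hF : BddBelow (range F)) (hG : BddAbove (range G))
    (hF0 : 0 ≤ (⨅ i, F i) + ⨆ i, F i) (hG0 : (⨅ i, G i) + (⨆ i, G i) ≤ 0)
    (h₁ : ∀ i j, F i ≤ G j + B₁) (h₂ : F i₀ ≤ G i₀ + B₂) : 0 ≤ B₁ + B₂ := by
  have : Nonempty ι := ⟨i₀⟩
  have a : (⨆ i, F i) - B₁ ≤ ⨅ j, G j :=
    le_ciInf fun j => sub_le_iff_le_add.2 (ciSup_le fun i => h₁ i j)
  have b : (⨅ i, F i) ≤ F i₀ := ciInf_le hF i₀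
  have c : G i₀ ≤ ⨆ i, G i := le_ciSup hG i₀
  linarith

/-! ### The viscosity inequality at a maximum of the doubled function -/

/-- A pointwise bound `G` on the differences of second differences of `u` passes to the operators
of the glued functions, up to an error which is an integral over `(0, ρ]`. -/
theorem dirOp_glue_sub_le {N : ℕ} {φ₁ φ₂ u : RN N → ℝ} {x y ξ η : RN N} {C s ρ A K : ℝ}
    {G : ℝ → ℝ} (hC : 0 ≤ C) (h0 : 0 < s) (h1 : s < 1) (hρ : 0 < ρ)
    (hu : Continuous u) (hK : ∀ x, |u x| ≤ K)
    (hφ₁ : Continuous φ₁) (hφ₂ : Continuous φ₂) (hx : u x = φ₁ x) (hy : u y = φ₂ y)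
    (hA₁ : ∀ v : RN N, ‖v‖ ≤ ρ → |secondDiff φ₁ x v| ≤ A * ‖v‖ ^ 2)
    (hA₂ : ∀ v : RN N, ‖v‖ ≤ ρ → |secondDiff φ₂ y v| ≤ A * ‖v‖ ^ 2)
    (hξ : ‖ξ‖ = 1) (hη : ‖η‖ = 1)
    (hGi : IntegrableOn (fun τ => G τ / τ ^ (1 + 2 * s)) (Ioi 0))
    (hG : ∀ τ, 0 < τ → secondDiff u x (τ • ξ) - secondDiff u y (τ • η) ≤ G τ) :
    dirOp C s ξ (glue φ₁ u x ρ) x ≤ dirOp C s η (glue φ₂ u y ρ) y +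
      C * ((∫ τ in Ioi (0 : ℝ), G τ / τ ^ (1 + 2 * s)) +
        ∫ τ in Ioc 0 ρ, (2 * A * τ ^ (2 - (1 + 2 * s)) + |G τ / τ ^ (1 + 2 * s)|)) := by
  have hi₁ := integrableOn_secondDiff_glue h0 h1 hρ hx hu hφ₁ hK hA₁ hξ
  have hi₂ := integrableOn_secondDiff_glue h0 h1 hρ hy hu hφ₂ hK hA₂ hη
  have hpow : IntegrableOn (fun τ : ℝ => 2 * A * τ ^ (2 - (1 + 2 * s))) (Ioc 0 ρ) := by
    have hi := (intervalIntegral.intervalIntegrable_rpow' (a := 0) (b := ρ)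
      (r := 2 - (1 + 2 * s)) (by linarith)).const_mul (2 * A)
    rwa [intervalIntegrable_iff_integrableOn_Ioc_of_le hρ.le] at hi
  have hRi : IntegrableOn (fun τ => 2 * A * τ ^ (2 - (1 + 2 * s)) + |G τ / τ ^ (1 + 2 * s)|)
      (Ioc 0 ρ) := hpow.add (hGi.mono_set Ioc_subset_Ioi_self).abs
  have hRi' := (integrable_indicator_iff (measurableSet_Ioc (a := (0 : ℝ)) (b := ρ))).2 hRi
  rw [dirOp, dirOp, ← mul_add]
  refine mul_le_mul_of_nonneg_left ?_ hC
  rw [← sub_le_iff_le_add', ← integral_sub hi₁ hi₂]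
  have e : ∫ τ in Ioc 0 ρ, (2 * A * τ ^ (2 - (1 + 2 * s)) + |G τ / τ ^ (1 + 2 * s)|) =
      ∫ τ in Ioi (0 : ℝ), (Ioc 0 ρ).indicator
        (fun τ => 2 * A * τ ^ (2 - (1 + 2 * s)) + |G τ / τ ^ (1 + 2 * s)|) τ := by
    rw [setIntegral_indicator measurableSet_Ioc, inter_eq_right.2 Ioc_subset_Ioi_self]
  rw [e, ← integral_add hGi hRi'.integrableOn]
  refine setIntegral_mono_on (hi₁.sub hi₂) (hGi.add hRi'.integrableOn) measurableSet_Ioi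
    fun τ (hτ : 0 < τ) => ?_
  have hp := Real.rpow_pos_of_pos hτ (1 + 2 * s)
  have hnξ : ‖τ • ξ‖ = τ := by rw [norm_smul, hξ, mul_one, Real.norm_of_nonneg hτ.le]
  have hnη : ‖τ • η‖ = τ := by rw [norm_smul, hη, mul_one, Real.norm_of_nonneg hτ.le]
  rw [secondDiff_glue hρ.le hx, secondDiff_glue hρ.le hy, hnξ, hnη, ← sub_div]
  by_cases h : τ ≤ ρ
  · have a1 := (abs_le.1 (hA₁ (τ • ξ) (hnξ.trans_le h))).2
    have a2 := (abs_le.1 (hA₂ (τ • η) (hnη.trans_le h))).1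
    rw [hnξ] at a1
    rw [hnη] at a2
    rw [if_pos h, if_pos h, indicator_of_mem (show τ ∈ Ioc 0 ρ from ⟨hτ, h⟩), Real.rpow_sub hτ,
      Real.rpow_two, ← mul_div_assoc]
    have h3 : (secondDiff φ₁ x (τ • ξ) - secondDiff φ₂ y (τ • η)) / τ ^ (1 + 2 * s) ≤
        2 * A * τ ^ 2 / τ ^ (1 + 2 * s) := by
      gcongr
      linarith
    have h4 := neg_abs_le (G τ / τ ^ (1 + 2 * s))
    linarith
  · rw [if_neg h, if_neg h, indicator_of_notMem (fun hm : τ ∈ Ioc 0 ρ => h hm.2), add_zero]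
    gcongr
    exact hG τ hτ

theorem tendsto_integral_Ioc_zero {f : ℝ → ℝ} {δ : ℝ} (hδ : 0 < δ)
    (hf : IntegrableOn f (Ioc 0 δ)) :
    Tendsto (fun ρ : ℝ => ∫ τ in Ioc 0 ρ, f τ) (𝓝[>] 0) (𝓝 0) := by
  have hv : Tendsto (fun ρ : ℝ => volume.restrict (Ioc 0 δ) (Ioc 0 ρ)) (𝓝[>] 0) (𝓝 0) := by
    refine tendsto_of_tendsto_of_tendsto_of_le_of_le tendsto_const_nhds ?_ (fun _ => zero_le)
      (fun ρ => Measure.restrict_apply_le _ _)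
    simp only [Real.volume_Ioc, sub_zero]
    refine Tendsto.mono_left ?_ nhdsWithin_le_nhds
    simpa using ENNReal.tendsto_ofReal (continuous_id.tendsto (0 : ℝ))
  have h := Integrable.tendsto_setIntegral_nhds_zero hf hv
  refine h.congr' ?_
  filter_upwards [Ioc_mem_nhdsGT hδ] with ρ hρ
  rw [Measure.restrict_restrict measurableSet_Ioc,
    inter_eq_left.2 (Ioc_subset_Ioc_right hρ.2)]

/-- The difference of the two viscosity inequalities at a maximum of the doubled function, with test
functions glued on balls of radius `ρ → 0`. Inside these balls the test functions at `x` and `y` do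
not see the pairing of increments, but their second differences are quadratic and, because `s < 1`,
contribute nothing in the limit. -/
theorem IsDoublingMax.nonneg_integral {N : ℕ} {C s α ε β c K : ℝ} {u : RN N → ℝ} {x y : RN N}
    (H : IsDoublingMax α ε β u x y) (hC : 0 < C) (hs : 1 / 2 < s) (hs1 : s < 1) (hc : 0 < c)
    (ha : 0 < α) (ha1 : α ≤ 1) (hε : 0 ≤ ε) (hβ : 0 ≤ β) (hxy : x ≠ y) (hu : Continuous u)
    (hK : ∀ x, |u x| ≤ K) (hv : IsViscositySolution C s univ (fun _ => 0) u) :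
    0 ≤ ε * ‖x - y‖ ^ α * (2 / ‖x - y‖) ^ (2 * s) *
        (∫ σ in Ioi (0 : ℝ), (orthGain α σ + radialGain c α σ) / σ ^ (1 + 2 * s)) +
      2 * β * ∫ σ in Ioi (0 : ℝ), quadLin σ / σ ^ (1 + 2 * s) := by
  have hne : x - y ≠ 0 := sub_ne_zero.2 hxy
  have hr : 0 < ‖x - y‖ := norm_pos_iff.2 hne
  have h0 : 0 < s := by linarith
  set r := ‖x - y‖ with hrdef
  set k := 2 / r with hk
  have hk0 : 0 < k := by positivity
  -- In units of `|x - y| / 2` both gains are independent of the maximum point.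
  set G₁ : ℝ → ℝ := fun t => ε * r ^ α * orthGain α (k * t) + β * quadLin t with hG₁
  set G₂ : ℝ → ℝ := fun t => ε * r ^ α * radialGain c α (k * t) + β * quadLin t with hG₂
  have hsplit : ∀ f : ℝ → ℝ, (fun t : ℝ => (ε * r ^ α * f (k * t) + β * quadLin t) /
      t ^ (1 + 2 * s)) = fun t => ε * r ^ α * (f (k * t) / t ^ (1 + 2 * s)) +
        β * (quadLin t / t ^ (1 + 2 * s)) := fun f => by
    funext t
    ring
  have hqi := integrableOn_quadLin_div_rpow hs hs1
  have hoi := integrableOn_orthGain_div_rpow hs hs1 ha.le ha1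
  have hri := integrableOn_radialGain_div_rpow hc hs1 ha ha1
  have hint : ∀ f : ℝ → ℝ, IntegrableOn (fun t => f t / t ^ (1 + 2 * s)) (Ioi 0) →
      IntegrableOn (fun t => (ε * r ^ α * f (k * t) + β * quadLin t) / t ^ (1 + 2 * s))
        (Ioi 0) ∧
      ∫ t in Ioi (0 : ℝ), (ε * r ^ α * f (k * t) + β * quadLin t) / t ^ (1 + 2 * s) =
        ε * r ^ α * k ^ (2 * s) * (∫ t in Ioi (0 : ℝ), f t / t ^ (1 + 2 * s)) +
          β * ∫ t in Ioi (0 : ℝ), quadLin t / t ^ (1 + 2 * s) := by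
    intro f hf
    have i1 := (IntegrableOn.comp_mul_div_rpow hk0 hf).const_mul (ε * r ^ α)
    have i2 := hqi.const_mul β
    rw [hsplit]
    refine ⟨i1.add i2, ?_⟩
    rw [integral_add i1 i2, integral_const_mul, integral_const_mul,
      integral_comp_mul_div_rpow f _ hk0, add_sub_cancel_left, mul_assoc (ε * r ^ α)]
  obtain ⟨hG₁i, hG₁e⟩ := hint _ hoi
  obtain ⟨hG₂i, hG₂e⟩ := hint _ hri
  -- Fixing one variable of the doubled function gives test functions touching `u` globally, smooth
  -- near `x` and `y` because `x ≠ y`.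
  set φ₁ : RN N → ℝ := fun p => u x + ε * (‖p - y‖ ^ α - r ^ α) + β * (penalty p - penalty x)
    with hφ₁
  set φ₂ : RN N → ℝ := fun q => u y - ε * (‖x - q‖ ^ α - r ^ α) with hφ₂
  have hpen := contDiff_penalty (N := N)
  have hφ₁c : Continuous φ₁ := by
    have := hpen.continuous
    have h2 : Continuous fun p : RN N => ‖p - y‖ ^ α :=
      Continuous.rpow_const (by fun_prop) fun _ => Or.inr ha.le
    fun_prop
  have hφ₂c : Continuous φ₂ := by
    have h2 : Continuous fun q : RN N => ‖x - q‖ ^ α :=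
      Continuous.rpow_const (by fun_prop) fun _ => Or.inr ha.le
    fun_prop
  have hφ₁d : ∀ p, p ≠ y → ContDiffAt ℝ 2 φ₁ p := fun p hp => by
    have hn : ContDiffAt ℝ 2 (fun p : RN N => ‖p - y‖ ^ α) p :=
      ((contDiffAt_id.sub contDiffAt_const).norm ℝ (sub_ne_zero.2 hp)).rpow_const_of_ne
        (norm_ne_zero_iff.2 (sub_ne_zero.2 hp))
    exact (contDiffAt_const.add (contDiffAt_const.mul (hn.sub contDiffAt_const))).add
      (contDiffAt_const.mul (hpen.contDiffAt.sub contDiffAt_const))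
  have hφ₂d : ∀ q, q ≠ x → ContDiffAt ℝ 2 φ₂ q := fun q hq => by
    have hn : ContDiffAt ℝ 2 (fun q : RN N => ‖x - q‖ ^ α) q :=
      ((contDiffAt_const.sub contDiffAt_id).norm ℝ (sub_ne_zero.2 hq.symm)).rpow_const_of_ne
        (norm_ne_zero_iff.2 (sub_ne_zero.2 hq.symm))
    exact contDiffAt_const.sub (contDiffAt_const.mul (hn.sub contDiffAt_const))
  have hx : u x = φ₁ x := by simp [hφ₁, hrdef]
  have hy : u y = φ₂ y := by simp [hφ₂, hrdef]
  have ht₁ : ∀ p, u p ≤ φ₁ p := fun p => by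
    have := H p y
    simp only [hφ₁]
    linarith
  have ht₂ : ∀ q, φ₂ q ≤ u q := fun q => by
    have := H x q
    simp only [hφ₂]
    linarith
  obtain ⟨A₁, hA₁0, δ₁, hδ₁, hA₁⟩ := (hφ₁d x hxy).exists_secondDiff_le
  obtain ⟨A₂, hA₂0, δ₂, hδ₂, hA₂⟩ := (hφ₂d y hxy.symm).exists_secondDiff_le
  set A := max A₁ A₂ with hA
  -- The contribution of `(0, ρ]` vanishes as `ρ → 0`.
  have herr : ∀ G : ℝ → ℝ, IntegrableOn (fun t => G t / t ^ (1 + 2 * s)) (Ioi 0) →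
      Tendsto (fun ρ : ℝ => ∫ τ in Ioc 0 ρ, (2 * A * τ ^ (2 - (1 + 2 * s)) +
        |G τ / τ ^ (1 + 2 * s)|)) (𝓝[>] 0) (𝓝 0) := by
    intro G hG
    refine tendsto_integral_Ioc_zero one_pos ?_
    have hi := (intervalIntegral.intervalIntegrable_rpow' (a := 0) (b := 1)
      (r := 2 - (1 + 2 * s)) (by linarith)).const_mul (2 * A)
    rw [intervalIntegrable_iff_integrableOn_Ioc_of_le zero_le_one] at hi
    exact hi.add (hG.mono_set Ioc_subset_Ioi_self).abs
  have hρineq : ∀ᶠ ρ : ℝ in 𝓝[>] 0, 0 ≤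
      C * ((∫ τ in Ioi (0 : ℝ), G₁ τ / τ ^ (1 + 2 * s)) +
        ∫ τ in Ioc 0 ρ, (2 * A * τ ^ (2 - (1 + 2 * s)) + |G₁ τ / τ ^ (1 + 2 * s)|)) +
      C * ((∫ τ in Ioi (0 : ℝ), G₂ τ / τ ^ (1 + 2 * s)) +
        ∫ τ in Ioc 0 ρ, (2 * A * τ ^ (2 - (1 + 2 * s)) + |G₂ τ / τ ^ (1 + 2 * s)|)) := by
    filter_upwards [Ioc_mem_nhdsGT (lt_min (half_pos hr) (lt_min hδ₁ hδ₂))] with ρ hρ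
    have hρr : ρ < r := (hρ.2.trans (min_le_left _ _)).trans_lt (half_lt_self hr)
    have hb₁ : ∀ v : RN N, ‖v‖ ≤ ρ → |secondDiff φ₁ x v| ≤ A * ‖v‖ ^ 2 := fun v hv =>
      (hA₁ v (hv.trans (hρ.2.trans ((min_le_right _ _).trans (min_le_left _ _))))).trans
        (mul_le_mul_of_nonneg_right (le_max_left _ _) (by positivity))
    have hb₂ : ∀ v : RN N, ‖v‖ ≤ ρ → |secondDiff φ₂ y v| ≤ A * ‖v‖ ^ 2 := fun v hv =>
      (hA₂ v (hv.trans (hρ.2.trans ((min_le_right _ _).trans (min_le_right _ _))))).trans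
        (mul_le_mul_of_nonneg_right (le_max_right _ _) (by positivity))
    have hsub := hv.1 x ρ φ₁ (mem_univ x) hρ.1 (subset_univ _) (fun p hp => hφ₁d p ?_) hx
      fun p _ => ht₁ p
    swap
    · rintro rfl
      rw [mem_closedBall_iff_norm, norm_sub_rev] at hp
      linarith
    have hsup := hv.2 y ρ φ₂ (mem_univ y) hρ.1 (subset_univ _) (fun q hq => hφ₂d q ?_) hy
      fun q _ => ht₂ q
    swap
    · rintro rfl
      rw [mem_closedBall_iff_norm] at hq
      linarith
    have hsphere : ∀ ξ : Metric.sphere (0 : RN N) 1, ‖(ξ : RN N)‖ = 1 := fun ξ =>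
      mem_sphere_zero_iff_norm.1 ξ.2
    have he : ‖r⁻¹ • (x - y)‖ = 1 := by
      rw [norm_smul, norm_inv, Real.norm_of_nonneg hr.le, inv_mul_cancel₀ hr.ne']
    have hbelow : BddBelow (range fun ξ : Metric.sphere (0 : RN N) 1 =>
        dirOp C s (ξ : RN N) (glue φ₁ u x ρ) x) := by
      refine ⟨-(C * ∫ τ in Ioi (0 : ℝ), (if τ ≤ ρ then A * τ ^ 2 else 4 * K) /
        τ ^ (1 + 2 * s)), ?_⟩
      rintro _ ⟨ξ, rfl⟩
      exact (abs_le.1 (abs_dirOp_glue_le hC.le h0 hs1 hρ.1 hx hK hb₁ (hsphere ξ))).1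
    have habove : BddAbove (range fun ξ : Metric.sphere (0 : RN N) 1 =>
        dirOp C s (ξ : RN N) (glue φ₂ u y ρ) y) := by
      refine ⟨C * ∫ τ in Ioi (0 : ℝ), (if τ ≤ ρ then A * τ ^ 2 else 4 * K) /
        τ ^ (1 + 2 * s), ?_⟩
      rintro _ ⟨ξ, rfl⟩
      exact (abs_le.1 (abs_dirOp_glue_le hC.le h0 hs1 hρ.1 hy hK hb₂ (hsphere ξ))).2
    refine nonneg_of_inf_add_sup (⟨r⁻¹ • (x - y), mem_sphere_zero_iff_norm.2 he⟩ :
      Metric.sphere (0 : RN N) 1) hbelow habove hsub hsup ?_ ?_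
    · intro ξ η
      exact dirOp_glue_sub_le hC.le h0 hs1 hρ.1 hu hK hφ₁c hφ₂c hx hy hb₁ hb₂ (hsphere ξ)
        (hsphere η) hG₁i fun τ hτ => H.secondDiff_sub_le ha.le (by linarith) hε hβ hr hτ.le
          (hsphere ξ) (hsphere η)
    · exact dirOp_glue_sub_le hC.le h0 hs1 hρ.1 hu hK hφ₁c hφ₂c hx hy hb₁ hb₂ he he hG₂i
        fun τ hτ => H.secondDiff_radial_sub_le c hβ hr hτ.le
  have hlim := ge_of_tendsto ((((herr G₁ hG₁i).const_add _).const_mul C).add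
    (((herr G₂ hG₂i).const_add _).const_mul C)) hρineq
  rw [add_zero, add_zero, ← mul_add] at hlim
  have h := nonneg_of_mul_nonneg_right hlim hC
  simp only [hG₁, hG₂] at h
  rw [hG₁e, hG₂e] at h
  simp only [add_div]
  rw [integral_add hoi hri]
  linarith

/-! ### The Liouville property -/

/-- The penalization makes the doubled function attain its maximum, at a point where its value is
at least that at any prescribed `(a, b)`. -/
theorem exists_isDoublingMax {N : ℕ} {α ε β K : ℝ} {u : RN N → ℝ} (ha : 0 < α) (hε : 0 < ε)
    (hβ : 0 < β) (hu : Continuous u) (hK : ∀ x, |u x| ≤ K) (a b : RN N) :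
    ∃ x y, IsDoublingMax α ε β u x y ∧
      u a - u b - ε * ‖a - b‖ ^ α - β * penalty a ≤
        u x - u y - ε * ‖x - y‖ ^ α - β * penalty x := by
  set Ψ : RN N × RN N → ℝ := fun w => u w.1 - u w.2 - ε * ‖w.1 - w.2‖ ^ α - β * penalty w.1 with hΨ
  have hc : Continuous Ψ := by
    have h1 := (contDiff_penalty (N := N)).continuous
    have h2 : Continuous fun w : RN N × RN N => ‖w.1 - w.2‖ ^ α :=
      Continuous.rpow_const (by fun_prop) fun _ => Or.inr ha.le
    fun_prop
  have hK0 : 0 ≤ K := (abs_nonneg _).trans (hK a)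
  set L : ℝ := 2 * K + |Ψ (a, b)| with hL
  have hL0 : 0 ≤ L := by positivity
  set M₁ := L / β with hM₁
  set M₂ := (L / ε) ^ α⁻¹ with hM₂
  have hfar : ∀ᶠ w in cocompact (RN N × RN N), Ψ w ≤ Ψ (a, b) := by
    filter_upwards [(tendsto_norm_cocompact_atTop (E := RN N × RN N)).eventually_ge_atTop
      (M₁ + M₂)] with w hw
    have h1 := (abs_le.1 (hK w.1)).2
    have h2 := (abs_le.1 (hK w.2)).1
    have h3 := neg_abs_le (Ψ (a, b))
    have hpen : 0 ≤ β * penalty w.1 := mul_nonneg hβ.le (penalty_nonneg _)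
    have hdist : 0 ≤ ε * ‖w.1 - w.2‖ ^ α := by positivity
    -- Far away in the product, either the first point or the distance is large.
    have hor : M₁ ≤ ‖w.1‖ ∨ M₂ ≤ ‖w.1 - w.2‖ := by
      by_contra! hcon
      have hM₂0 : 0 ≤ M₂ := by positivity
      have h4 : ‖w.2‖ ≤ ‖w.1‖ + ‖w.1 - w.2‖ := by
        have := norm_sub_le w.1 (w.1 - w.2)
        rwa [sub_sub_cancel] at this
      rcases le_total ‖w.1‖ ‖w.2‖ with h | h
      · rw [Prod.norm_def, max_eq_right h] at hw
        linarith
      · rw [Prod.norm_def, max_eq_left h] at hw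
        linarith
    have hbig : L ≤ ε * ‖w.1 - w.2‖ ^ α + β * penalty w.1 := by
      rcases hor with h | h
      · have h5 := mul_le_mul_of_nonneg_left (h.trans (norm_le_penalty w.1)) hβ.le
        rw [hM₁, mul_div_cancel₀ _ hβ.ne'] at h5
        linarith
      · have h5 := mul_le_mul_of_nonneg_left
          (Real.rpow_le_rpow (by positivity) h ha.le) hε.le
        rw [hM₂, Real.rpow_inv_rpow (by positivity) ha.ne', mul_div_cancel₀ _ hε.ne'] at h5
        linarith
    simp only [hΨ] at *
    linarith
  obtain ⟨⟨x, y⟩, hmax⟩ := hc.exists_forall_ge' (a, b) hfar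
  refine ⟨x, y, fun p q => ?_, hmax (a, b)⟩
  have := hmax (p, q)
  simp only [hΨ] at this
  linarith

/-- The hypothesis `hI` makes the main term of `IsDoublingMax.nonneg_integral` negative, and it
beats the penalization when `β` is small. -/
theorem sub_le_mul_norm_rpow {N : ℕ} {C s α ε c K : ℝ} {u : RN N → ℝ} (hC : 0 < C)
    (hs : 1 / 2 < s) (hs1 : s < 1) (hc : 0 < c) (ha : 0 < α) (ha1 : α ≤ 1)
    (hI : ∫ σ in Ioi (0 : ℝ), (orthGain α σ + radialGain c α σ) / σ ^ (1 + 2 * s) < 0)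
    (hε : 0 < ε) (hu : Continuous u) (hK : ∀ x, |u x| ≤ K)
    (hv : IsViscositySolution C s univ (fun _ => 0) u) (a b : RN N) :
    u a - u b ≤ ε * ‖a - b‖ ^ α := by
  by_contra! hab
  set θ := u a - u b - ε * ‖a - b‖ ^ α with hθ
  have hθ0 : 0 < θ := sub_pos.2 hab
  set I := ∫ σ in Ioi (0 : ℝ), (orthGain α σ + radialGain c α σ) / σ ^ (1 + 2 * s) with hIdef
  set J := ∫ σ in Ioi (0 : ℝ), quadLin σ / σ ^ (1 + 2 * s) with hJ
  have hJ0 : 0 ≤ J := setIntegral_nonneg measurableSet_Ioi fun σ (hσ : 0 < σ) =>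
    div_nonneg (quadLin_nonneg hσ.le) (Real.rpow_nonneg hσ.le _)
  -- The maximum points satisfy `|x - y| ≤ R`, so that the coefficient of `I` is at least `m`.
  set R := (2 * K / ε) ^ α⁻¹ with hR
  set m := ε * (2 ^ (2 * s) * R ^ (α - 2 * s)) with hm
  have hK0 : 0 < K := by
    have h1 := abs_le.1 (hK a)
    have h2 := abs_le.1 (hK b)
    have : 0 ≤ ε * ‖a - b‖ ^ α := by positivity
    linarith
  have hR0 : 0 < R := by positivity
  have hm0 : 0 < m := by positivity
  have hpa : 0 ≤ penalty a := penalty_nonneg a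
  set β := min (θ / (2 * (penalty a + 1))) (m * -I / (2 * J + 1)) with hβ
  have hmI : 0 < m * -I := mul_pos hm0 (neg_pos.2 hI)
  have hβ0 : 0 < β := lt_min (by positivity) (by positivity)
  have hβ1 : β * penalty a < θ := by
    have : β ≤ θ / (2 * (penalty a + 1)) := min_le_left _ _
    rw [le_div_iff₀ (by positivity)] at this
    nlinarith
  have hβ2 : 2 * β * J < m * -I := by
    have : β ≤ m * -I / (2 * J + 1) := min_le_right _ _
    rw [le_div_iff₀ (by positivity)] at this
    linarith
  obtain ⟨x, y, H, hxy⟩ := exists_isDoublingMax ha hε hβ0 hu hK a b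
  have hpos : 0 < u x - u y - ε * ‖x - y‖ ^ α := by
    have := mul_nonneg hβ0.le (penalty_nonneg x)
    linarith
  have hne : x ≠ y := by
    rintro rfl
    simp [Real.zero_rpow ha.ne'] at hpos
  have hr : 0 < ‖x - y‖ := norm_pos_iff.2 (sub_ne_zero.2 hne)
  have hrR : ‖x - y‖ ≤ R := by
    have h1 := (abs_le.1 (hK x)).2
    have h2 := (abs_le.1 (hK y)).1
    rw [hR, Real.le_rpow_inv_iff_of_pos hr.le (by positivity) ha, le_div_iff₀ hε]
    linarith
  have hcoef : m ≤ ε * ‖x - y‖ ^ α * (2 / ‖x - y‖) ^ (2 * s) := by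
    have e : ‖x - y‖ ^ α * (2 / ‖x - y‖) ^ (2 * s) = 2 ^ (2 * s) * ‖x - y‖ ^ (α - 2 * s) := by
      rw [Real.div_rpow (by norm_num) hr.le, Real.rpow_sub hr]
      ring
    rw [mul_assoc, e, hm]
    have := Real.rpow_le_rpow_of_nonpos hr hrR (by linarith : α - 2 * s ≤ 0)
    gcongr
  have := H.nonneg_integral hC hs hs1 hc ha ha1 hε.le hβ0.le hne hu hK hv
  rw [← hIdef, ← hJ] at this
  nlinarith

theorem eq_of_isViscositySolution {N : ℕ} {C s c K : ℝ} {u : RN N → ℝ} (hC : 0 < C)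
    (hs : 1 / 2 < s) (hs1 : s < 1) (hc : 0 < c) (hneg : hFun c s < 0) (hu : Continuous u)
    (hK : ∀ x, |u x| ≤ K) (hv : IsViscositySolution C s univ (fun _ => 0) u) (a b : RN N) :
    u a = u b := by
  obtain ⟨α, ha, ha1, hI⟩ := exists_integral_gain_neg hc hs hs1 hneg
  have h : ∀ a b, u a ≤ u b := by
    intro a b
    have ht : Tendsto (fun ε : ℝ => ε * ‖a - b‖ ^ α) (𝓝[>] 0) (𝓝 0) := by
      refine Tendsto.mono_left ?_ nhdsWithin_le_nhds
      simpa using (continuous_id.mul_const (‖a - b‖ ^ α)).tendsto 0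
    refine sub_nonpos.1 (ge_of_tendsto ht ?_)
    filter_upwards [self_mem_nhdsWithin] with ε hε
    exact sub_le_mul_norm_rpow hC hs hs1 hc ha ha1 hI hε hu hK hv a b
  exact le_antisymm (h a b) (h b a)

theorem theorem1p3 (c : ℝ) (hc : c ∈ Set.Ioc (1 : ℝ) 2) :
    ∃ s₀ : ℝ, IsThreshold c s₀ ∧
      ∀ s ∈ Set.Ioo s₀ 1, ∀ C : ℝ, 0 < C → ∀ N : ℕ, 1 ≤ N → ∀ u : RN N → ℝ,
        Continuous u → (∃ K : ℝ, ∀ x, |u x| ≤ K) →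
        IsViscositySolution C s Set.univ (fun _ => 0) u →
        ∃ a : ℝ, ∀ x, u x = a := by
  obtain ⟨s₀, hs₀⟩ := exists_isThreshold hc
  refine ⟨s₀, hs₀, fun s hs C hC N _ u hu ⟨K, hK⟩ hv => ⟨u 0, fun x => ?_⟩⟩
  exact eq_of_isViscositySolution hC (hs₀.1.1.trans hs.1) hs.2 (by linarith [hc.1])
    (hs₀.2.2.2 s ⟨hs.1, hs.2.le⟩) hu hK hv x 0
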